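/- Work over $\mathbb{C}$, on $\mathbb{P}^1 \times \mathbb{P}^1$ with homogeneous coordinates $(x_0:x_1)$ on the first factor and $(z_0:z_1)$ on the second. A curve of bidegree $(p,q)$ is the zero scheme of a nonzero form that is homogeneous of degree $p$ in $x_0,x_1$ and of degree $q$ in $z_0,z_1$ (it may be reducible or non-reduced); a line of bidegree $(1,0)$ or $(0,1)$ is a curve of that bidegree. The length of a finite scheme $Z$ over $\mathbb{C}$ is $\dim_{\mathbb{C}} \mathrm{H}^0(\mathcal{O}_Z)$. Let $c \ge 0$ be an integer and let $C \subset \mathbb{P}^1 \times \mathbb{P}^1$ be a curve of bidegree $(1,c)$. Let $Z \subset C$ be a finite closed subscheme of length $l$, with ideal sheaf $\mathcal{I}_Z \subset \mathcal{O}_{\mathbb{P}^1 \times \mathbb{P}^1}$. Let $m \ge 1$ and $n \ge c-1$ be integers such that $m+n \ge l-1$. Assume that $\operatorname{length}(Z \cap D) \le n+1$ for every line $D \subset \mathbb{P}^1 \times \mathbb{P}^1$ of bidegree $(1,0)$, and that $\operatorname{length}(Z \cap E) \le m$ for every line $E \subset \mathbb{P}^1 \times \mathbb{P}^1$ of bidegree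 $(0,1)$. Then \[ \mathrm{H}^1(\mathcal{I}_Z(m,n)) = \{0\}, \qquad \text{where } \mathcal{I}_Z(m,n) = \mathcal{I}_Z \otimes \mathcal{O}(m,n). \] -/

import Mathlib

open CategoryTheory AlgebraicGeometry

noncomputable section

namespace QuadricSurface

/-! ### The projective line over `ℂ` -/

/-- The standard grading of `ℂ[X₀, X₁]` by total degree. -/
abbrev grading : ℕ → Submodule ℂ (MvPolynomial (Fin 2) ℂ) :=
  MvPolynomial.homogeneousSubmodule (Fin 2) ℂ

instance gradedAlgebraGrading : GradedAlgebra grading :=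
  MvPolynomial.gradedAlgebra

/-- The projective line `ℙ¹ = Proj ℂ[X₀, X₁]`. -/
abbrev P1 : Scheme.{0} := Proj grading

/-- The structure morphism `ℙ¹ ⟶ Spec ℂ`. -/
def P1.toSpec : P1 ⟶ Spec (.of ℂ) :=
  Proj.toSpecZero grading ≫ Spec.map (CommRingCat.ofHom (algebraMap ℂ (grading 0)))

/-- The standard affine open `{X_i ≠ 0}` of `ℙ¹`. -/
abbrev P1.chart (i : Fin 2) : P1.Opens := Proj.basicOpen grading (MvPolynomial.X i)

lemma X_mem_grading (i : Fin 2) : MvPolynomial.X (R := ℂ) i ∈ grading 1 :=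
  MvPolynomial.isHomogeneous_X ℂ i

/-- The regular function `X_k / X_i` on `{X_i ≠ 0}`. -/
def P1.ratio (i k : Fin 2) : Γ(P1, P1.chart i) :=
  (Proj.awayToSection grading (MvPolynomial.X i)).hom
    (HomogeneousLocalization.Away.mk grading (X_mem_grading i) 1 (MvPolynomial.X k)
      (X_mem_grading k))

/-! ### The quadric surface and its standard affine charts -/

/-- The smooth quadric surface `ℙ¹ × ℙ¹` over `ℂ`. -/
abbrev Quadric : Scheme.{0} := Limits.pullback P1.toSpec P1.toSpec

/-- The projection to the first factor, which has homogeneous coordinates `(x₀ : x₁)`. -/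
abbrev pr1 : Quadric ⟶ P1 := Limits.pullback.fst P1.toSpec P1.toSpec

/-- The projection to the second factor, which has homogeneous coordinates `(z₀ : z₁)`. -/
abbrev pr2 : Quadric ⟶ P1 := Limits.pullback.snd P1.toSpec P1.toSpec

/-- The structure morphism `ℙ¹ × ℙ¹ ⟶ Spec ℂ`. -/
def toSpec : Quadric ⟶ Spec (.of ℂ) := pr1 ≫ P1.toSpec

lemma isAffineOpen_chart (i j : Fin 2) :
    IsAffineOpen (pr1 ⁻¹ᵁ P1.chart i ⊓ pr2 ⁻¹ᵁ P1.chart j) := by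
  have hi : IsAffineOpen (P1.chart i) :=
    Proj.isAffineOpen_basicOpen grading _ (X_mem_grading i) one_pos
  have hj : IsAffineOpen (P1.chart j) :=
    Proj.isAffineOpen_basicOpen grading _ (X_mem_grading j) one_pos
  have : IsAffine (P1.chart i).toScheme := hi
  have : IsAffine (P1.chart j).toScheme := hj
  let f : Limits.pullback ((P1.chart i).ι ≫ P1.toSpec) ((P1.chart j).ι ≫ P1.toSpec) ⟶ Quadric :=
    Limits.pullback.map _ _ _ _ (P1.chart i).ι (P1.chart j).ι (𝟙 _) (by simp) (by simp)
  have hf : f.opensRange = pr1 ⁻¹ᵁ P1.chart i ⊓ pr2 ⁻¹ᵁ P1.chart j := by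
    ext1
    have := Scheme.Pullback.range_map ((P1.chart i).ι ≫ P1.toSpec) ((P1.chart j).ι ≫ P1.toSpec)
      P1.toSpec P1.toSpec (P1.chart i).ι (P1.chart j).ι (𝟙 _) (by simp) (by simp)
    simpa [f] using this
  rw [← hf]
  exact isAffineOpen_opensRange f

instance isSeparated_quadric : Quadric.IsSeparated :=
  ⟨by rw [← Limits.terminal.comp_from pr1]; infer_instance⟩

/-- The affine chart `{x_i ≠ 0, z_j ≠ 0}`, where `a = (i, j)`. -/
def chart (a : Fin 2 × Fin 2) : Quadric.affineOpens :=
  ⟨pr1 ⁻¹ᵁ P1.chart a.1 ⊓ pr2 ⁻¹ᵁ P1.chart a.2, isAffineOpen_chart a.1 a.2⟩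

/-- The intersection of two charts. -/
def chart₂ (a b : Fin 2 × Fin 2) : Quadric.affineOpens :=
  ⟨(chart a).1 ⊓ (chart b).1, (chart a).2.inf (chart b).2⟩

/-- The intersection of three charts. -/
def chart₃ (a b c : Fin 2 × Fin 2) : Quadric.affineOpens :=
  ⟨(chart a).1 ⊓ (chart b).1 ⊓ (chart c).1, (chart₂ a b).2.inf (chart c).2⟩

lemma chart_le_pr1 (a : Fin 2 × Fin 2) : (chart a).1 ≤ pr1 ⁻¹ᵁ P1.chart a.1 := inf_le_left

lemma chart_le_pr2 (a : Fin 2 × Fin 2) : (chart a).1 ≤ pr2 ⁻¹ᵁ P1.chart a.2 := inf_le_right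

lemma chart₂_le_left (a b : Fin 2 × Fin 2) : chart₂ a b ≤ chart a :=
  Subtype.coe_le_coe.mp inf_le_left

lemma chart₂_le_right (a b : Fin 2 × Fin 2) : chart₂ a b ≤ chart b :=
  Subtype.coe_le_coe.mp inf_le_right

lemma chart₃_le₁₂ (a b c : Fin 2 × Fin 2) : chart₃ a b c ≤ chart₂ a b :=
  Subtype.coe_le_coe.mp inf_le_left

lemma chart₃_le₂₃ (a b c : Fin 2 × Fin 2) : chart₃ a b c ≤ chart₂ b c :=
  Subtype.coe_le_coe.mp (le_inf (inf_le_left.trans inf_le_right) inf_le_right)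

lemma chart₃_le₁₃ (a b c : Fin 2 × Fin 2) : chart₃ a b c ≤ chart₂ a c :=
  Subtype.coe_le_coe.mp (le_inf (inf_le_left.trans inf_le_left) inf_le_right)

/-- Restriction of regular functions. -/
def res {U V : Quadric.Opens} (h : U ≤ V) : Γ(Quadric, V) →+* Γ(Quadric, U) :=
  (Quadric.presheaf.map (homOfLE h).op).hom

/-- Constants, as regular functions on an open subset `U` of `ℙ¹ × ℙ¹`. -/
def const (U : Quadric.Opens) : ℂ →+* Γ(Quadric, U) :=
  (res le_top).comp (toSpec.appTop.hom.comp (Scheme.ΓSpecIso (.of ℂ)).inv.hom)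

/-- The regular function `x_k / x_i` on the chart `{x_i ≠ 0, z_j ≠ 0}`, where `a = (i, j)`. -/
def xRatio (a : Fin 2 × Fin 2) (k : Fin 2) : Γ(Quadric, (chart a).1) :=
  res (chart_le_pr1 a) ((pr1.app (P1.chart a.1)).hom (P1.ratio a.1 k))

/-- The regular function `z_k / z_j` on the chart `{x_i ≠ 0, z_j ≠ 0}`, where `a = (i, j)`. -/
def zRatio (a : Fin 2 × Fin 2) (k : Fin 2) : Γ(Quadric, (chart a).1) :=
  res (chart_le_pr2 a) ((pr2.app (P1.chart a.2)).hom (P1.ratio a.2 k))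

/-! ### Closed subschemes: length, curves of a given bidegree

A closed subscheme of `ℙ¹ × ℙ¹` is given by its quasi-coherent ideal sheaf
`I : Quadric.IdealSheafData`; the scheme itself is `I.subscheme`. One has `Z ⊂ C` if and only if
`I_C ≤ I_Z`, and `Z ∩ D` is given by `I_Z ⊔ I_D`. -/

/-- The structure morphism `Z ⟶ Spec ℂ` of a closed subscheme `Z`. -/
def structureMorphism (Z : Quadric.IdealSheafData) : Z.subscheme ⟶ Spec (.of ℂ) :=
  Z.subschemeι ≫ toSpec

/-- `Z` is a finite scheme (over `ℂ`). -/
def IsFiniteScheme (Z : Quadric.IdealSheafData) : Prop :=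
  IsFinite (structureMorphism Z)

/-- The length of a finite scheme `Z`, that is, `dim_ℂ H⁰(𝒪_Z)`. -/
def length (Z : Quadric.IdealSheafData) : ℕ :=
  letI : Algebra ℂ Γ(Z.subscheme, ⊤) :=
    ((structureMorphism Z).appTop.hom.comp (Scheme.ΓSpecIso (.of ℂ)).inv.hom).toAlgebra
  Module.finrank ℂ Γ(Z.subscheme, ⊤)

/-- `F ∈ ℂ[x₀, x₁, z₀, z₁]` is bihomogeneous of bidegree `(p, q)`: the variables `x_k = X (inl k)`
have bidegree `(1, 0)` and the variables `z_k = X (inr k)` have bidegree `(0, 1)`. -/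
def IsBihomogeneous (F : MvPolynomial (Fin 2 ⊕ Fin 2) ℂ) (p q : ℕ) : Prop :=
  F.IsWeightedHomogeneous (Sum.elim (fun _ ↦ ((1, 0) : ℕ × ℕ)) (fun _ ↦ (0, 1))) (p, q)

/-- The dehomogenization of `F` on the chart `{x_i ≠ 0, z_j ≠ 0}`, where `a = (i, j)`:
`x_k` is replaced by `x_k / x_i` and `z_k` is replaced by `z_k / z_j`. -/
def dehomogenize (F : MvPolynomial (Fin 2 ⊕ Fin 2) ℂ) (a : Fin 2 × Fin 2) :
    Γ(Quadric, (chart a).1) :=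
  F.eval₂ (const (chart a).1) (Sum.elim (xRatio a) (zRatio a))

/-- `C` is a curve of bidegree `(p, q)`: the zero scheme of a nonzero bihomogeneous form of
bidegree `(p, q)`, whose ideal on each standard chart is generated by the dehomogenization of the
form. Such a curve may be reducible or non-reduced. A line is a curve of bidegree `(1, 0)` or
`(0, 1)`. -/
def IsCurve (p q : ℕ) (C : Quadric.IdealSheafData) : Prop :=
  ∃ F : MvPolynomial (Fin 2 ⊕ Fin 2) ℂ, F ≠ 0 ∧ IsBihomogeneous F p q ∧
    ∀ a, C.ideal (chart a) = Ideal.span {dehomogenize F a}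

/-! ### Cohomology of twisted ideal sheaves

On the chart `{x_i ≠ 0, z_j ≠ 0}` the sheaf `𝒪(m, n)` is freely generated by `x_i ^ m * z_j ^ n`.
In these trivializations, the Čech complex of `I(m, n) = I ⊗ 𝒪(m, n)` relative to the affine cover
of `ℙ¹ × ℙ¹` by the four standard charts is as follows. A section of `I(m, n)` on
`U_a ∩ U_b ∩ ...` is represented by its coefficient with respect to the generator on the first
chart `U_a`; this coefficient is a section of `I`. -/

/-- The transition function `(x_k / x_i) ^ m * (z_l / z_j) ^ n` of `𝒪(m, n)` on `U_a ∩ U_b`, where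
`a = (i, j)` and `b = (k, l)`. A negative power of a ratio is written as a positive power of the
inverse ratio. -/
def transition (m n : ℤ) (a b : Fin 2 × Fin 2) : Γ(Quadric, (chart₂ a b).1) :=
  res (chart₂_le_left a b) (xRatio a b.1) ^ m.toNat *
    res (chart₂_le_right a b) (xRatio b a.1) ^ (-m).toNat *
    (res (chart₂_le_left a b) (zRatio a b.2) ^ n.toNat *
      res (chart₂_le_right a b) (zRatio b a.2) ^ (-n).toNat)

/-- Restriction of sections of an ideal sheaf. -/
def resIdeal (I : Quadric.IdealSheafData) {U V : Quadric.affineOpens} (h : U ≤ V) :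
    I.ideal V →+ I.ideal U where
  toFun f := ⟨res h f.1, I.ideal_le_comap_ideal h f.2⟩
  map_zero' := by ext; simp
  map_add' f g := by ext; simp

/-- Čech `0`-cochains of `I(m, n)`. -/
abbrev C0 (I : Quadric.IdealSheafData) : Type := ∀ a, I.ideal (chart a)

/-- Čech `1`-cochains of `I(m, n)`. -/
abbrev C1 (I : Quadric.IdealSheafData) : Type := ∀ a b, I.ideal (chart₂ a b)

/-- Čech `2`-cochains of `I(m, n)`. -/
abbrev C2 (I : Quadric.IdealSheafData) : Type := ∀ a b c, I.ideal (chart₃ a b c)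

/-- The differential `(d f)_{ab} = f_b - f_a`, with coefficients relative to the generator
on `U_a`. -/
def d0 (I : Quadric.IdealSheafData) (m n : ℤ) : C0 I →+ C1 I where
  toFun f a b :=
    transition m n a b • resIdeal I (chart₂_le_right a b) (f b) -
      resIdeal I (chart₂_le_left a b) (f a)
  map_zero' := by ext; simp
  map_add' f g := by ext; simp; ring

/-- The differential `(d g)_{abc} = g_{bc} - g_{ac} + g_{ab}`, with coefficients relative to the
generator on `U_a`. -/
def d1 (I : Quadric.IdealSheafData) (m n : ℤ) : C1 I →+ C2 I where
  toFun g a b c :=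
    res (chart₃_le₁₂ a b c) (transition m n a b) • resIdeal I (chart₃_le₂₃ a b c) (g b c) -
      resIdeal I (chart₃_le₁₃ a b c) (g a c) + resIdeal I (chart₃_le₁₂ a b c) (g a b)
  map_zero' := by ext; simp
  map_add' f g := by ext; simp; ring

/-- The cohomology group `H¹(ℙ¹ × ℙ¹, I(m, n))`: Čech `1`-cocycles modulo `1`-coboundaries, for the
standard affine cover of the separated scheme `ℙ¹ × ℙ¹`. -/
abbrev H1 (I : Quadric.IdealSheafData) (m n : ℤ) : Type :=
  (d1 I m n).ker ⧸ (d0 I m n).range.addSubgroupOf (d1 I m n).ker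

end QuadricSurface

end

/-! ### Spanning a finite algebra on two generators by monomials of bounded bidegree. -/

section Algebra

open Module

variable {K : Type*} [Field K]

/-! Suppose first that `n ≥ 0`. Since `H¹(𝒪(m, n)) = 0`, it suffices that every section of `𝒪(m, n)`
over `Z` lifts to a global one. As `Z` is finite, some forms `x₀ + α x₁` and `z₀ + β z₁` vanish
nowhere on it; put `u = x₁ / (x₀ + α x₁)` and `v = z₁ / (z₀ + β z₁)`. These generate `A = H⁰(𝒪_Z)`
(`Coordinates.adjoin_eq_top`), and dividing by `(x₀ + α x₁) ^ m (z₀ + β z₁) ^ n` turns the lifting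
problem into the assertion that the monomials `u ^ i v ^ j` with `i ≤ m`, `j ≤ n` span `A`
(`Coordinates.subsingleton_H1`).

That assertion is pure algebra (`monomialSpan_eq_top`). For `s = u - a`, the quotient `A / (s)` is
the ring of the intersection of `Z` with a line, and `A / Ann(s)` that of the residual scheme; their
dimensions add up to `dim A`. One removes a line and inducts on `m + n`: powers of the other
coordinate span `A / (s)`, and `s` times the monomials of smaller bidegree accounts for the rest.
The choice of line must preserve all the bounds. If some line `u = a` meets `Z` in the maximal
length `n + 1`, that line is removed; otherwise any line `v = b` meeting `Z` will do. The bounds on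
`A / (u - a)` and `A / (v - b)` come from the length hypotheses on lines
(`Coordinates.finrank_quotient_le_length`).

The vanishing of `H¹(𝒪(m, n))` for `m, n ≥ -1` (`exists_cochain_of_cocycle`) is obtained by a
contracting homotopy of the Čech complex, one Laurent monomial at a time.

In the remaining case `n = -1` and `c = 0`, so `C` is itself a line of bidegree `(1, 0)`; the bound
for this line makes `Z` empty, and only the vanishing for `𝒪(m, -1)` is needed. -/

lemma span_pow_eq_top_of_adjoin_eq_top {A : Type*} [CommRing A] [Algebra K A]
    [FiniteDimensional K A] {v : A} (hv : Algebra.adjoin K {v} = ⊤) {N : ℕ}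
    (hN : finrank K A ≤ N) : Submodule.span K {x | ∃ j < N, x = v ^ j} = ⊤ := by
  refine eq_top_iff.mpr fun x _ ↦ ?_
  have hx : x ∈ Algebra.adjoin K {v} := hv ▸ trivial
  rw [Algebra.adjoin_singleton_eq_range_aeval] at hx
  obtain ⟨p, rfl⟩ := hx
  rcases subsingleton_or_nontrivial A with h | h
  · rw [Subsingleton.elim ((Polynomial.aeval v).toRingHom p) 0]
    exact zero_mem _
  have hint : IsIntegral K v := Algebra.IsIntegral.isIntegral v
  have hmod : Polynomial.aeval v (p %ₘ minpoly K v) = Polynomial.aeval v p := by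
    conv_rhs => rw [← Polynomial.modByMonic_add_div p (minpoly K v)]
    simp
  change Polynomial.aeval v p ∈ _
  rw [← hmod, Polynomial.aeval_eq_sum_range]
  refine Submodule.sum_mem _ fun i hi ↦ Submodule.smul_mem _ _ ?_
  refine Submodule.subset_span ⟨i, ?_, rfl⟩
  have h1 := Polynomial.natDegree_modByMonic_lt p (minpoly.monic hint) (minpoly.ne_one K v)
  have h2 := minpoly.natDegree_le (A := K) v
  simp at hi
  omega

lemma finrank_quotient_span_le {A B : Type*} [CommRing A] [CommRing B] [Algebra K A] [Algebra K B]
    [FiniteDimensional K A] (f : A →ₐ[K] B) (hf : Function.Surjective f) (s : A) {t : B}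
    (ht : f s = t) :
    finrank K (B ⧸ Ideal.span {t}) ≤ finrank K (A ⧸ Ideal.span {s}) := by
  let g : (A ⧸ Ideal.span {s}) →ₐ[K] (B ⧸ Ideal.span {t}) :=
    Ideal.Quotient.liftₐ _ ((Ideal.Quotient.mkₐ K _).comp f) (by
      intro a ha
      obtain ⟨c, rfl⟩ := Ideal.mem_span_singleton.mp ha
      simp only [map_mul, AlgHom.comp_apply, ht, Ideal.Quotient.mkₐ_eq_mk]
      rw [Ideal.Quotient.eq_zero_iff_mem.mpr (Ideal.mem_span_singleton_self t), zero_mul])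
  refine LinearMap.finrank_le_finrank_of_surjective (f := g.toLinearMap) fun y ↦ ?_
  obtain ⟨y, rfl⟩ := Ideal.Quotient.mk_surjective y
  obtain ⟨x, rfl⟩ := hf y
  exact ⟨Ideal.Quotient.mk _ x, rfl⟩

lemma finrank_quotient_le {A : Type*} [CommRing A] [Algebra K A]
    [FiniteDimensional K A] (I : Ideal A) : finrank K (A ⧸ I) ≤ finrank K A :=
  LinearMap.finrank_le_finrank_of_surjective (f := (Ideal.Quotient.mkₐ K I).toLinearMap)
    Ideal.Quotient.mk_surjective

/-- Multiplication by `s` identifies `A / Ann(s)` with the ideal `(s)`. This is the length count for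
the residual exact sequence of `Z` with respect to a line. -/
lemma finrank_quotient_add_finrank_quotient_torsionOf {A : Type*} [CommRing A] [Algebra K A]
    [FiniteDimensional K A] (s : A) :
    finrank K (A ⧸ Ideal.span {s}) + finrank K (A ⧸ Ideal.torsionOf A A s) = finrank K A := by
  rw [((Ideal.quotTorsionOfEquivSpanSingleton A A s).restrictScalars K).finrank_eq]
  exact ((Ideal.span {s}).restrictScalars K).finrank_quotient_add_finrank

lemma adjoin_image_eq_top {A B : Type*} [CommRing A] [CommRing B] [Algebra K A] [Algebra K B]
    (f : A →ₐ[K] B) (hf : Function.Surjective f) {S : Set A} (hS : Algebra.adjoin K S = ⊤) :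
    Algebra.adjoin K (f '' S) = ⊤ := by
  rw [Algebra.adjoin_image, hS, Algebra.map_top, AlgHom.range_eq_top]
  exact hf

/-- If `A / (s)` is spanned by the powers `v ^ j`, `j < N`, and every element of the residual
algebra is congruent to an element of `P`, then `A` is spanned by the `v ^ j` and `s • P`. -/
lemma exists_eq_add_mul {A : Type*} [CommRing A] [Algebra K A] [FiniteDimensional K A] {s v : A}
    (hv : Algebra.adjoin K {Ideal.Quotient.mk (Ideal.span {s}) v} = ⊤) {N : ℕ}
    (hN : finrank K (A ⧸ Ideal.span {s}) ≤ N) (P : Submodule K A)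
    (hP : ∀ x : A, ∃ y ∈ P, s * x = s * y) (x : A) :
    ∃ q ∈ Submodule.span K {x | ∃ j < N, x = v ^ j}, ∃ y ∈ P, x = q + s * y := by
  have h := span_pow_eq_top_of_adjoin_eq_top hv hN
  have himg : {x | ∃ j < N, x = (Ideal.Quotient.mk (Ideal.span {s}) v) ^ j} =
      (Ideal.Quotient.mkₐ K (Ideal.span {s})).toLinearMap '' {x | ∃ j < N, x = v ^ j} := by
    ext y
    constructor
    · rintro ⟨j, hj, rfl⟩
      exact ⟨v ^ j, ⟨j, hj, rfl⟩, by simp⟩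
    · rintro ⟨_, ⟨j, hj, rfl⟩, rfl⟩
      exact ⟨j, hj, by simp⟩
  rw [himg, Submodule.span_image] at h
  have hx : (Ideal.Quotient.mkₐ K (Ideal.span {s})).toLinearMap x ∈
      (⊤ : Submodule K (A ⧸ Ideal.span {s})) := trivial
  rw [← h] at hx
  obtain ⟨q, hq, hqx⟩ := hx
  have hd : x - q ∈ Ideal.span {s} := Ideal.Quotient.eq.mp hqx.symm
  obtain ⟨z, hz⟩ := Ideal.mem_span_singleton.mp hd
  obtain ⟨y, hy, hzy⟩ := hP z
  exact ⟨q, hq, y, hy, by rw [← hzy, ← hz]; ring⟩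

/-- On the line `u = a` the generator `u` becomes a constant, so `v` alone generates. -/
lemma adjoin_mk_eq_top {A : Type*} [CommRing A] [Algebra K A] {u v : A}
    (h : Algebra.adjoin K {u, v} = ⊤) (a : K) :
    Algebra.adjoin K {Ideal.Quotient.mk (Ideal.span {u - algebraMap K A a}) v} = ⊤ := by
  have h2 := adjoin_image_eq_top (Ideal.Quotient.mkₐ K (Ideal.span {u - algebraMap K A a}))
    Ideal.Quotient.mk_surjective h
  rw [eq_top_iff, ← h2]
  refine Algebra.adjoin_le ?_
  rintro _ ⟨x, rfl | rfl, rfl⟩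
  · have : (Ideal.Quotient.mk (Ideal.span {x - algebraMap K A a})) x =
      algebraMap K _ a := Ideal.Quotient.eq.mpr (Ideal.mem_span_singleton_self _)
    simp only [Ideal.Quotient.mkₐ_eq_mk, this]
    exact Subalgebra.algebraMap_mem _ _
  · exact Algebra.subset_adjoin rfl

/-- The span of the monomials of bidegree at most `(m, n)`. -/
def monomialSpan (K : Type*) [Field K] {A : Type*} [CommRing A] [Algebra K A] (u v : A)
    (m n : ℕ) : Submodule K A :=
  Submodule.span K {x | ∃ i ≤ m, ∃ j ≤ n, x = u ^ i * v ^ j}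

lemma monomialSpan_swap {A : Type*} [CommRing A] [Algebra K A] (u v : A) (m n : ℕ) :
    monomialSpan K u v m n = monomialSpan K v u n m := by
  unfold monomialSpan
  congr 1
  ext x
  constructor <;> rintro ⟨i, hi, j, hj, rfl⟩ <;> exact ⟨j, hj, i, hi, mul_comm _ _⟩

lemma span_pow_le_monomialSpan {A : Type*} [CommRing A] [Algebra K A] (u v : A) (m n : ℕ) :
    Submodule.span K {x | ∃ j < n + 1, x = v ^ j} ≤ monomialSpan K u v m n := by
  refine Submodule.span_mono ?_
  rintro _ ⟨j, hj, rfl⟩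
  exact ⟨0, by simp, j, by omega, by simp⟩

lemma sub_mul_mem_monomialSpan {A : Type*} [CommRing A] [Algebra K A] {u v : A} {m n : ℕ} (a : K)
    {y : A} (hy : y ∈ monomialSpan K u v m n) :
    (u - algebraMap K A a) * y ∈ monomialSpan K u v (m + 1) n := by
  induction hy using Submodule.span_induction with
  | mem x hx =>
    obtain ⟨i, hi, j, hj, rfl⟩ := hx
    rw [sub_mul, ← Algebra.smul_def]
    refine sub_mem (Submodule.subset_span ⟨i + 1, by omega, j, hj, by ring⟩)
      (Submodule.smul_mem _ _ (Submodule.subset_span ⟨i, by omega, j, hj, rfl⟩))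
  | zero => simp
  | add x y _ _ hx hy => rw [mul_add]; exact add_mem hx hy
  | smul c x _ hx => rw [mul_smul_comm]; exact Submodule.smul_mem _ _ hx

/-- Elements congruent modulo `Ann(s)` have the same product with `s`. This passes from spanning the
residual algebra to the hypothesis `hP` of `exists_eq_add_mul`. -/
lemma exists_mul_eq_mul_of_monomialSpan_eq_top {A : Type*} [CommRing A] [Algebra K A] {u v s : A}
    {m n : ℕ} (h : monomialSpan K (Ideal.Quotient.mk (Ideal.torsionOf A A s) u)
      (Ideal.Quotient.mk (Ideal.torsionOf A A s) v) m n = ⊤) (x : A) :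
    ∃ y ∈ monomialSpan K u v m n, s * x = s * y := by
  have himg : {x | ∃ i ≤ m, ∃ j ≤ n, x = (Ideal.Quotient.mk (Ideal.torsionOf A A s) u) ^ i *
      (Ideal.Quotient.mk (Ideal.torsionOf A A s) v) ^ j} =
      (Ideal.Quotient.mkₐ K (Ideal.torsionOf A A s)).toLinearMap ''
        {x | ∃ i ≤ m, ∃ j ≤ n, x = u ^ i * v ^ j} := by
    ext y
    constructor
    · rintro ⟨i, hi, j, hj, rfl⟩
      exact ⟨_, ⟨i, hi, j, hj, rfl⟩, by simp⟩
    · rintro ⟨_, ⟨i, hi, j, hj, rfl⟩, rfl⟩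
      exact ⟨i, hi, j, hj, by simp⟩
  rw [monomialSpan, himg, Submodule.span_image] at h
  have hx : (Ideal.Quotient.mkₐ K (Ideal.torsionOf A A s)).toLinearMap x ∈
      (⊤ : Submodule K (A ⧸ Ideal.torsionOf A A s)) := trivial
  rw [← h] at hx
  obtain ⟨y, hy, hyx⟩ := hx
  refine ⟨y, hy, ?_⟩
  have : x - y ∈ Ideal.torsionOf A A s := Ideal.Quotient.eq.mp hyx.symm
  rw [Ideal.mem_torsionOf_iff, smul_eq_mul] at this
  linear_combination this

/-- In a nontrivial finite-dimensional algebra over an algebraically closed field every element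
has an eigenvalue. -/
lemma exists_finrank_quotient_sub_pos [IsAlgClosed K] {A : Type*} [CommRing A] [Algebra K A]
    [FiniteDimensional K A] [Nontrivial A] (u : A) :
    ∃ a : K, 0 < finrank K (A ⧸ Ideal.span {u - algebraMap K A a}) := by
  obtain ⟨a, ha⟩ := spectrum.nonempty_of_isAlgClosed_of_finiteDimensional K u
  refine ⟨a, ?_⟩
  have : Ideal.span {u - algebraMap K A a} ≠ ⊤ := by
    rw [Ne, Ideal.span_singleton_eq_top]
    intro h
    exact ha (by simpa [spectrum.mem_resolventSet_iff] using h.neg)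
  have := Ideal.Quotient.nontrivial_iff.mpr this
  exact finrank_pos

/-- Induction by residuation. The algebra is quantified inside the induction because it is replaced
by `A / Ann(s)`. Removing a line `u = a` lowers `m` by one, and removing a line `v = b` lowers `n`
by one. -/
theorem monomialSpan_eq_top [IsAlgClosed K] (N : ℕ) : ∀ {m n : ℕ}, m + n = N →
    ∀ {A : Type*} [CommRing A] [Algebra K A] [FiniteDimensional K A] {u v : A},
    Algebra.adjoin K {u, v} = ⊤ → finrank K A ≤ m + n + 1 →
    (∀ a : K, finrank K (A ⧸ Ideal.span {u - algebraMap K A a}) ≤ n + 1) →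
    (∀ b : K, finrank K (A ⧸ Ideal.span {v - algebraMap K A b}) ≤ m + 1) →
    monomialSpan K u v m n = ⊤ := by
  induction N with
  | zero =>
    intro m n hmn A _ _ _ u v huv hA _ _
    obtain ⟨rfl, rfl⟩ : m = 0 ∧ n = 0 := by omega
    rw [eq_top_iff]
    have h1 : finrank K A ≤ 1 := by omega
    rcases subsingleton_or_nontrivial A with h | h
    · intro x _
      rw [Subsingleton.elim x 0]
      exact zero_mem _
    have h2 : finrank K A = 1 := le_antisymm h1 finrank_pos
    rw [finrank_eq_one_iff_of_nonzero' (1 : A) one_ne_zero] at h2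
    intro x _
    obtain ⟨c, rfl⟩ := h2 x
    exact Submodule.smul_mem _ _ (Submodule.subset_span ⟨0, le_rfl, 0, le_rfl, by simp⟩)
  | succ N ih =>
    intro m n hmn A _ _ _ u v huv hA hu hv
    have hvu : Algebra.adjoin K {v, u} = ⊤ := by rwa [Set.pair_comm]
    rcases subsingleton_or_nontrivial A with h | h
    · rw [eq_top_iff]
      intro x _
      rw [Subsingleton.elim x 0]
      exact zero_mem _
    by_cases hcase : ∃ a : K, finrank K (A ⧸ Ideal.span {u - algebraMap K A a}) = n + 1
    · obtain ⟨a, ha⟩ := hcase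
      set s := u - algebraMap K A a with hs
      have hdim := finrank_quotient_add_finrank_quotient_torsionOf (K := K) s
      rw [eq_top_iff]
      rintro x -
      rcases m with - | m
      -- For `m = 0` the line `u = a` already accounts for the whole dimension `n + 1`, so `s = 0`
      -- in `A` and powers of `v` suffice.
      · have : finrank K (A ⧸ Ideal.torsionOf A A s) = 0 := by omega
        have := finrank_zero_iff.mp this
        have htop : Ideal.torsionOf A A s = ⊤ := Ideal.Quotient.subsingleton_iff.mp this
        have hmul : ∀ x, s * x = 0 := fun x ↦ by
          have : x ∈ Ideal.torsionOf A A s := htop ▸ trivial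
          rwa [Ideal.mem_torsionOf_iff, smul_eq_mul, mul_comm] at this
        obtain ⟨q, hq, y, -, rfl⟩ := exists_eq_add_mul (adjoin_mk_eq_top huv a) ha.le ⊥
          (fun x ↦ ⟨0, zero_mem _, by rw [hmul, hmul]⟩) x
        rw [hmul, add_zero]
        exact span_pow_le_monomialSpan _ _ _ _ hq
      · let π := Ideal.Quotient.mkₐ K (Ideal.torsionOf A A s)
        have hπ : Function.Surjective π := Ideal.Quotient.mk_surjective
        -- Taking out the full `n + 1` leaves a residual dimension so small that the tightened bound
        -- on the quotients by `v - b` holds automatically.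
        have hA' : finrank K (A ⧸ Ideal.torsionOf A A s) ≤ m + 1 := by omega
        have key := ih (m := m) (n := n) (by omega) (u := π u) (v := π v)
          (by simpa [Set.image_pair] using adjoin_image_eq_top π hπ huv) (by omega)
          (fun a ↦ (finrank_quotient_span_le π hπ (u - algebraMap K A a) (by simp)).trans (hu a))
          (fun b ↦ (finrank_quotient_le _).trans hA')
        obtain ⟨q, hq, y, hy, rfl⟩ := exists_eq_add_mul (adjoin_mk_eq_top huv a) ha.le _
          (exists_mul_eq_mul_of_monomialSpan_eq_top key) x
        exact add_mem (span_pow_le_monomialSpan _ _ _ _ hq) (sub_mul_mem_monomialSpan a hy)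
    · have hu' : ∀ a : K, finrank K (A ⧸ Ideal.span {u - algebraMap K A a}) ≤ n := fun a ↦ by
        have := hu a
        have : finrank K (A ⧸ Ideal.span {u - algebraMap K A a}) ≠ n + 1 :=
          fun h ↦ hcase ⟨a, h⟩
        omega
      -- No quotient by `u - a` attains `n + 1`, so the bound for these may drop by one along with
      -- `n`. For `n = 0` they would all vanish, contradicting the existence of an eigenvalue of
      -- `u`.
      rcases n with - | n
      · obtain ⟨a, ha⟩ := exists_finrank_quotient_sub_pos (K := K) u
        have := hu' a
        omega
      -- Any line `v = b` meeting `Z` works: it removes at least one from the dimension, which is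
      -- all that lowering `n` by one demands.
      obtain ⟨b, hb⟩ := exists_finrank_quotient_sub_pos (K := K) v
      set s := v - algebraMap K A b with hs
      have hdim := finrank_quotient_add_finrank_quotient_torsionOf (K := K) s
      let π := Ideal.Quotient.mkₐ K (Ideal.torsionOf A A s)
      have hπ : Function.Surjective π := Ideal.Quotient.mk_surjective
      have key := ih (m := m) (n := n) (by omega) (u := π u) (v := π v)
        (by simpa [Set.image_pair] using adjoin_image_eq_top π hπ huv) (by omega)
        (fun a ↦ (finrank_quotient_span_le π hπ (u - algebraMap K A a) (by simp)).trans (hu' a))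
        (fun b ↦ (finrank_quotient_span_le π hπ (v - algebraMap K A b) (by simp)).trans (hv b))
      rw [monomialSpan_swap, eq_top_iff]
      rw [monomialSpan_swap] at key
      rintro x -
      obtain ⟨q, hq, y, hy, rfl⟩ := exists_eq_add_mul (adjoin_mk_eq_top hvu b) (hv b) _
        (exists_mul_eq_mul_of_monomialSpan_eq_top key) x
      exact add_mem (span_pow_le_monomialSpan _ _ _ _ hq) (sub_mul_mem_monomialSpan b hy)

end Algebra

noncomputable section

namespace QuadricSurface

/-! ### Coordinate rings of the standard charts of the projective line. -/

section ProjectiveLine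

open MvPolynomial HomogeneousLocalization

/-- The homomorphism `ℂ[T] → ℂ[X₀, X₁]_(X_i)`, `T ↦ X_k / X_i`. -/
def awayEval (i k : Fin 2) : Polynomial ℂ →+* Away grading (X (R := ℂ) i) :=
  Polynomial.eval₂RingHom ((fromZeroRingHom grading _).comp (algebraMap ℂ (grading 0)))
    (Away.mk grading (X_mem_grading i) 1 (X k) (X_mem_grading k))

lemma val_fromZeroRingHom (i : Fin 2) (c : ℂ) :
    (fromZeroRingHom grading (Submonoid.powers (X (R := ℂ) i)) (algebraMap ℂ (grading 0) c)).val =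
      algebraMap (MvPolynomial (Fin 2) ℂ) _ (C c) := by
  rw [← Localization.mk_one_eq_algebraMap]
  rfl

lemma val_mk_X (i k : Fin 2) :
    (Away.mk grading (X_mem_grading i) 1 (X k) (X_mem_grading k)).val *
      algebraMap (MvPolynomial (Fin 2) ℂ) (Localization.Away (X (R := ℂ) i)) (X i) =
      algebraMap (MvPolynomial (Fin 2) ℂ) _ (X k) := by
  rw [Away.val_mk, Localization.mk_eq_mk']
  have := IsLocalization.mk'_spec (Localization.Away (X (R := ℂ) i)) (X k)
    (⟨X i ^ 1, 1, rfl⟩ : Submonoid.powers (X (R := ℂ) i))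
  simpa only [pow_one] using this

/-- The inclusion of the degree zero part into the localization. -/
def awayVal (i : Fin 2) : Away grading (X (R := ℂ) i) →+* Localization.Away (X (R := ℂ) i) :=
  algebraMap _ _

lemma awayVal_awayEval_C (i k : Fin 2) (c : ℂ) :
    awayVal i (awayEval i k (Polynomial.C c)) = algebraMap (MvPolynomial (Fin 2) ℂ) _ (C c) := by
  rw [awayEval, Polynomial.coe_eval₂RingHom, Polynomial.eval₂_C]
  exact val_fromZeroRingHom i c

lemma awayVal_awayEval_X (i k : Fin 2) :
    awayVal i (awayEval i k Polynomial.X) *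
      algebraMap (MvPolynomial (Fin 2) ℂ) (Localization.Away (X (R := ℂ) i)) (X i) =
      algebraMap (MvPolynomial (Fin 2) ℂ) _ (X k) := by
  rw [awayEval, Polynomial.coe_eval₂RingHom, Polynomial.eval₂_X]
  exact val_mk_X i k

/-- Setting `X_i = 1` and calling the other variable `T`. -/
def setOne (i : Fin 2) : MvPolynomial (Fin 2) ℂ →+* Polynomial ℂ :=
  eval₂Hom Polynomial.C (fun j ↦ if j = i then (1 : Polynomial ℂ) else Polynomial.X)

@[simp] lemma setOne_C (i : Fin 2) (c : ℂ) : setOne i (C c) = Polynomial.C c := by simp [setOne]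

@[simp] lemma setOne_X_self (i : Fin 2) : setOne i (X i) = 1 := by simp [setOne]

lemma setOne_X_of_ne {i k : Fin 2} (h : i ≠ k) : setOne i (X k) = Polynomial.X := by
  simp [setOne, h.symm]

/-- Setting `X_i = 1` extends to the localization and gives a left inverse. -/
lemma awayEval_injective {i k : Fin 2} (hik : i ≠ k) : Function.Injective (awayEval i k) := by
  have hψ : IsUnit (setOne i (X i)) := by simp
  let Ψ : Localization.Away (X (R := ℂ) i) →+* Polynomial ℂ := IsLocalization.Away.lift _ hψ
  have hΨ : ∀ a, Ψ (algebraMap _ _ a) = setOne i a := fun a ↦ IsLocalization.Away.lift_eq _ _ _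
  have : (Ψ.comp (awayVal i)).comp (awayEval i k) = RingHom.id _ := by
    refine Polynomial.ringHom_ext (fun c ↦ ?_) ?_
    · rw [RingHom.comp_apply, RingHom.comp_apply, awayVal_awayEval_C, hΨ, setOne_C]
      rfl
    · have := congrArg Ψ (awayVal_awayEval_X i k)
      rw [map_mul, hΨ, hΨ, setOne_X_self, setOne_X_of_ne hik, mul_one] at this
      exact this
  exact Function.LeftInverse.injective (g := Ψ.comp (awayVal i)) fun x ↦ congr($this x)

lemma eval₂_mul_of_isHomogeneous {σ R S : Type*} [CommSemiring R] [CommSemiring S] (f : R →+* S)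
    (g : σ → S) (r : S) {p : MvPolynomial σ R} {n : ℕ} (hp : p.IsHomogeneous n) :
    p.eval₂ f (fun j ↦ r * g j) = r ^ n * p.eval₂ f g := by
  rw [eval₂_eq, eval₂_eq, Finset.mul_sum]
  refine Finset.sum_congr rfl fun d hd ↦ ?_
  have : ∑ i ∈ d.support, d i = n := by
    have := hp (mem_support_iff.mp hd)
    simpa [Finsupp.weight_apply, Finsupp.sum] using this
  simp_rw [mul_pow, Finset.prod_mul_distrib, Finset.prod_pow_eq_pow_sum, this]
  ring

/-- For `a` homogeneous of degree `n`, homogeneity gives `a / X_i ^ n = a(X_0 / X_i, X_1 / X_i)`, a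
polynomial in `X_k / X_i`. -/
lemma awayEval_surjective {i k : Fin 2} (hik : i ≠ k) : Function.Surjective (awayEval i k) := by
  intro x
  obtain ⟨n, a, ha, rfl⟩ := Away.mk_surjective grading (X_mem_grading i) x
  let ι : MvPolynomial (Fin 2) ℂ →+* Localization.Away (X (R := ℂ) i) := algebraMap _ _
  have hunit : IsUnit (ι (X i)) := IsLocalization.Away.algebraMap_isUnit _
  let g : Fin 2 → Localization.Away (X (R := ℂ) i) :=
    fun j ↦ awayVal i (awayEval i k (setOne i (X j)))
  have hg : ∀ j, ι (X i) * g j = ι (X j) := fun j ↦ by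
    by_cases hj : j = i
    · subst hj
      simp [g]
    · obtain rfl : j = k := by omega
      rw [mul_comm]
      simp only [g, setOne_X_of_ne hik]
      exact awayVal_awayEval_X i j
  refine ⟨setOne i a, val_injective _ ?_⟩
  change awayVal i (awayEval i k _) = _
  have h1 : awayVal i (awayEval i k (setOne i a)) = a.eval₂ (ι.comp C) g := by
    have : ((awayVal i).comp (awayEval i k)).comp (setOne i) = eval₂Hom (ι.comp C) g := by
      refine MvPolynomial.ringHom_ext (fun c ↦ ?_) (fun j ↦ ?_)
      · rw [RingHom.comp_apply, RingHom.comp_apply, setOne_C, awayVal_awayEval_C, eval₂Hom_C]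
        rfl
      · rw [eval₂Hom_X']
        rfl
    exact congr($this a)
  have ha' : a.IsHomogeneous n := by simpa using ha
  have h2 := eval₂_mul_of_isHomogeneous (ι.comp C) g (ι (X i)) ha'
  have h4 : a.eval₂ (ι.comp C) (ι ∘ X) = ι a := by
    rw [← eval₂_comp_left, eval₂_eta]
  rw [show (fun j ↦ ι (X i) * g j) = ι ∘ X from funext hg, h4] at h2
  refine (hunit.pow n).mul_left_cancel ?_
  rw [h1, ← h2, Away.val_mk, Localization.mk_eq_mk', mul_comm]
  have := IsLocalization.mk'_spec (Localization.Away (X (R := ℂ) i)) a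
    (⟨X i ^ n, n, rfl⟩ : Submonoid.powers (X (R := ℂ) i))
  rw [map_pow] at this
  exact this.symm

/-! ### The charts of the projective line -/

/-- The inclusion of constants into the degree zero part of a localization. -/
def awayConst (i : Fin 2) : CommRingCat.of ℂ ⟶ CommRingCat.of (Away grading (X (R := ℂ) i)) :=
  CommRingCat.ofHom ((fromZeroRingHom grading _).comp (algebraMap ℂ (grading 0)))

lemma P1.ι_toSpec (i : Fin 2) : (P1.chart i).ι ≫ P1.toSpec = (P1.chart i).toSpecΓ ≫
    Spec.map (awayConst i ≫ Proj.awayToSection grading (X i)) := by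
  have h := Proj.awayι_toSpecZero grading (X i) (X_mem_grading i) one_pos
  rw [Proj.awayι, Category.assoc, Iso.inv_comp_eq, Proj.basicOpenIsoSpec_hom,
    Proj.basicOpenToSpec] at h
  rw [P1.toSpec, reassoc_of% h, awayConst]
  simp only [← Spec.map_comp, CommRingCat.ofHom_comp, Category.assoc]

/-- Constants on the chart `{X_i ≠ 0}`. -/
def P1.const (i : Fin 2) : CommRingCat.of ℂ ⟶ Γ(P1, P1.chart i) :=
  (Scheme.ΓSpecIso (.of ℂ)).inv ≫ P1.toSpec.appLE ⊤ (P1.chart i) le_top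

lemma P1.const_eq (i : Fin 2) :
    P1.const i = awayConst i ≫ Proj.awayToSection grading (X i) := by
  have hi : IsAffineOpen (P1.chart i) :=
    Proj.isAffineOpen_basicOpen grading _ (X_mem_grading i) one_pos
  have h : (P1.chart i).toSpecΓ ≫ Spec.map (P1.toSpec.appLE ⊤ (P1.chart i) le_top) =
      ((P1.chart i).ι ≫ P1.toSpec) ≫ (Spec (CommRingCat.of ℂ)).toSpecΓ := by
    have h1 := Scheme.Opens.toSpecΓ_SpecMap_appLE P1.toSpec ⊤ (P1.chart i) le_top
    have h2 := Scheme.Hom.resLE_comp_ι P1.toSpec (U := ⊤) (V := P1.chart i) le_top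
    rw [Scheme.Opens.toSpecΓ_top] at h1
    rw [← h2]
    exact h1
  rw [P1.ι_toSpec i] at h
  apply Spec.map_injective
  rw [← cancel_epi hi.isoSpec.hom, IsAffineOpen.isoSpec_hom, P1.const, Spec.map_comp,
    reassoc_of% h, toSpecΓ_SpecMap_ΓSpecIso_inv,
    Category.comp_id]

/-- The ring homomorphism `ℂ[T] → Γ(P1, {X_i ≠ 0})`, `T ↦ X_k / X_i`. -/
def P1.chartEval (i k : Fin 2) : Polynomial ℂ →+* Γ(P1, P1.chart i) :=
  Polynomial.eval₂RingHom (P1.const i).hom (P1.ratio i k)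

lemma P1.chartEval_bijective {i k : Fin 2} (hik : i ≠ k) :
    Function.Bijective (P1.chartEval i k) := by
  have : P1.chartEval i k = (Proj.awayToSection grading (X i)).hom.comp (awayEval i k) := by
    refine Polynomial.ringHom_ext (fun c ↦ ?_) ?_
    · simp only [chartEval, awayEval, RingHom.comp_apply, Polynomial.coe_eval₂RingHom,
        Polynomial.eval₂_C, P1.const_eq]
      rfl
    · simp only [chartEval, awayEval, RingHom.comp_apply, Polynomial.coe_eval₂RingHom,
        Polynomial.eval₂_X]
      rfl
  rw [this]
  have h : Function.Bijective (Proj.awayToSection grading (X i)).hom := by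
    have := (Proj.basicOpenIsoAway grading (X i) (X_mem_grading i)
      one_pos).commRingCatIsoToRingEquiv.bijective
    exact this
  exact h.comp ⟨awayEval_injective hik, awayEval_surjective hik⟩

/-- All three ratios come from the degree zero part of the localization at `X_i X_j`, where the
cocycle identity is an identity of fractions. -/
lemma P1.res_ratio {i j : Fin 2} (k : Fin 2) {U : P1.Opens} (hi : U ≤ P1.chart i)
    (hj : U ≤ P1.chart j) :
    P1.presheaf.map (homOfLE hi).op (P1.ratio i k) =
      P1.presheaf.map (homOfLE hi).op (P1.ratio i j) *
        P1.presheaf.map (homOfLE hj).op (P1.ratio j k) := by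
  have hU : U ≤ Proj.basicOpen grading (X i * X j) := by
    rw [Proj.basicOpen_mul]
    exact le_inf hi hj
  have key : ∀ (i' j' k' : Fin 2) (hx : X (R := ℂ) i * X j = X i' * X j') (h : U ≤ P1.chart i'),
      P1.presheaf.map (homOfLE h).op (P1.ratio i' k') =
      P1.presheaf.map (homOfLE hU).op ((Proj.awayToSection grading _).hom
        (awayMap grading (X_mem_grading j') hx (Away.mk grading (X_mem_grading i') 1 (X k')
      (X_mem_grading k')))) := by
    intro i' j' k' hx h
    have := congr($(Proj.awayMap_awayToSection grading (f := X i') (X_mem_grading j') hx)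
      (Away.mk grading (X_mem_grading i') 1 (X k') (X_mem_grading k')))
    have h2 : (Proj.awayToSection grading (X i * X j)).hom (awayMap grading (X_mem_grading j') hx
      (Away.mk grading (X_mem_grading i') 1 (X k') (X_mem_grading k'))) =
      P1.presheaf.map (homOfLE (Proj.basicOpen_mono _ _ _ ⟨_, hx⟩)).op (P1.ratio i' k') := this
    rw [h2, ← CommRingCat.comp_apply, ← Functor.map_comp]
    rfl
  rw [key i j k rfl hi, key i j j rfl hi, key j i k (mul_comm _ _) hj, ← map_mul, ← map_mul]
  congr 2
  apply val_injective
  rw [val_mul, awayMap_mk, awayMap_mk, awayMap_mk, Away.val_mk, Away.val_mk, Away.val_mk, Localization.mk_mul,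
    Localization.mk_eq_mk_iff, Localization.r_iff_exists]
  exact ⟨1, by simp; ring⟩

lemma P1.ratio_self (i : Fin 2) : P1.ratio i i = 1 := by
  rw [P1.ratio, ← map_one (Proj.awayToSection grading (X i)).hom]
  congr 1
  apply val_injective
  rw [Away.val_mk, val_one]
  simp

lemma P1.basicOpen_ratio (i j : Fin 2) :
    P1.basicOpen (P1.ratio i j) = P1.chart i ⊓ P1.chart j := by
  apply le_antisymm
  · refine le_inf (P1.basicOpen_le _) fun x hx ↦ ?_
    have hxi : x ∈ P1.chart i := P1.basicOpen_le _ hx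
    rw [Scheme.mem_basicOpen _ _ _ hxi] at hx
    have h := hx.map (Proj.stalkIso' grading x)
    have h2 := (Proj.stalkIso'_germ grading (P1.chart i) x hxi (P1.ratio i j))
    erw [h2] at h
    have hp : x.asHomogeneousIdeal.toIdeal.IsPrime := x.isPrime
    replace h : IsUnit (mapId grading (Submonoid.powers_le.mpr hxi)
      (Away.mk grading (X_mem_grading i) 1 (X j) (X_mem_grading j)) : AtPrime grading x.asHomogeneousIdeal.toIdeal) := h
    rw [← isUnit_iff_isUnit_val] at h
    intro hxj
    replace h : IsUnit (Localization.mk (X j) ⟨X i ^ 1, by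
      simpa using! hxi⟩ : Localization x.asHomogeneousIdeal.toIdeal.primeCompl) := h
    rw [Localization.mk_eq_mk', IsLocalization.AtPrime.isUnit_mk'_iff
      (Localization x.asHomogeneousIdeal.toIdeal.primeCompl) x.asHomogeneousIdeal.toIdeal] at h
    exact h hxj
  · set U := P1.chart i ⊓ P1.chart j
    have h := P1.res_ratio i (U := U) inf_le_left inf_le_right
    rw [P1.ratio_self, map_one] at h
    have h2 := P1.basicOpen_of_isUnit (IsUnit.of_mul_eq_one _ h.symm)
    rw [Scheme.basicOpen_res] at h2
    exact inf_eq_left.mp h2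

lemma P1.iSup_chart : ⨆ i, P1.chart i = ⊤ := by
  refine Proj.iSup_basicOpen_eq_top' grading X (fun i ↦ ⟨1, X_mem_grading i⟩) ?_
  refine eq_top_iff.mpr fun p _ ↦ ?_
  induction p using MvPolynomial.induction_on with
  | C a => exact Subalgebra.algebraMap_mem _ (algebraMap ℂ (grading 0) a)
  | add p q hp hq => exact add_mem (hp trivial) (hq trivial)
  | mul_X p i hp => exact mul_mem (hp trivial) (Algebra.subset_adjoin ⟨i, rfl⟩)

end ProjectiveLine

/-! ### The charts of the quadric -/

lemma res_res {U V W : Quadric.Opens} (h : U ≤ V) (h' : V ≤ W) (f : Γ(Quadric, W)) :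
    res h (res h' f) = res (h.trans h') f := by
  simp only [res]
  rw [← CommRingCat.comp_apply, ← Functor.map_comp]
  rfl

lemma res_self {U : Quadric.Opens} (h : U ≤ U) (f : Γ(Quadric, U)) : res h f = f := by
  simp [res]

lemma res_const {U V : Quadric.Opens} (h : U ≤ V) (c : ℂ) : res h (const V c) = const U c := by
  simp only [const, RingHom.comp_apply, res_res]

lemma app_res_pr1 {U : Quadric.Opens} {V V' : P1.Opens} (h : U ≤ pr1 ⁻¹ᵁ V) (hV : V ≤ V')
    (f : Γ(P1, V')) :
    res h ((pr1.app V).hom (P1.presheaf.map (homOfLE hV).op f)) =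
      res (h.trans (pr1.preimage_mono hV)) ((pr1.app V').hom f) :=
  congr($(Scheme.Hom.map_appLE pr1 h (homOfLE hV).op) f)

lemma app_res_pr2 {U : Quadric.Opens} {V V' : P1.Opens} (h : U ≤ pr2 ⁻¹ᵁ V) (hV : V ≤ V')
    (f : Γ(P1, V')) :
    res h ((pr2.app V).hom (P1.presheaf.map (homOfLE hV).op f)) =
      res (h.trans (pr2.preimage_mono hV)) ((pr2.app V').hom f) :=
  congr($(Scheme.Hom.map_appLE pr2 h (homOfLE hV).op) f)

lemma res_xRatio {a b : Fin 2 × Fin 2} (k : Fin 2) {U : Quadric.Opens} (ha : U ≤ (chart a).1)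
    (hb : U ≤ (chart b).1) :
    res ha (xRatio a k) = res ha (xRatio a b.1) * res hb (xRatio b k) := by
  have hU : U ≤ pr1 ⁻¹ᵁ (P1.chart a.1 ⊓ P1.chart b.1) :=
    le_inf (ha.trans (chart_le_pr1 a)) (hb.trans (chart_le_pr1 b))
  have h := P1.res_ratio k (U := P1.chart a.1 ⊓ P1.chart b.1) (i := a.1) (j := b.1) inf_le_left
    inf_le_right
  have h2 := congr(res hU ((pr1.app _).hom $h))
  rw [map_mul, map_mul, app_res_pr1, app_res_pr1, app_res_pr1] at h2
  simpa only [xRatio, res_res] using h2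

lemma res_zRatio {a b : Fin 2 × Fin 2} (k : Fin 2) {U : Quadric.Opens} (ha : U ≤ (chart a).1)
    (hb : U ≤ (chart b).1) :
    res ha (zRatio a k) = res ha (zRatio a b.2) * res hb (zRatio b k) := by
  have hU : U ≤ pr2 ⁻¹ᵁ (P1.chart a.2 ⊓ P1.chart b.2) :=
    le_inf (ha.trans (chart_le_pr2 a)) (hb.trans (chart_le_pr2 b))
  have h := P1.res_ratio k (U := P1.chart a.2 ⊓ P1.chart b.2) (i := a.2) (j := b.2) inf_le_left
    inf_le_right
  have h2 := congr(res hU ((pr2.app _).hom $h))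
  rw [map_mul, map_mul, app_res_pr2, app_res_pr2, app_res_pr2] at h2
  simpa only [zRatio, res_res] using h2

@[simp] lemma xRatio_self (a : Fin 2 × Fin 2) : xRatio a a.1 = 1 := by
  simp [xRatio, P1.ratio_self]

@[simp] lemma zRatio_self (a : Fin 2 × Fin 2) : zRatio a a.2 = 1 := by
  simp [zRatio, P1.ratio_self]

lemma res_xRatio_mul {a b : Fin 2 × Fin 2} {U : Quadric.Opens} (ha : U ≤ (chart a).1)
    (hb : U ≤ (chart b).1) : res ha (xRatio a b.1) * res hb (xRatio b a.1) = 1 := by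
  rw [← res_xRatio, xRatio_self, map_one]

lemma res_zRatio_mul {a b : Fin 2 × Fin 2} {U : Quadric.Opens} (ha : U ≤ (chart a).1)
    (hb : U ≤ (chart b).1) : res ha (zRatio a b.2) * res hb (zRatio b a.2) = 1 := by
  rw [← res_zRatio, zRatio_self, map_one]

lemma basicOpen_res {U V : Quadric.Opens} (h : U ≤ V) (f : Γ(Quadric, V)) :
    Quadric.basicOpen (res h f) = U ⊓ Quadric.basicOpen f :=
  Scheme.basicOpen_res _ _ _

lemma basicOpen_xRatio (a : Fin 2 × Fin 2) (k : Fin 2) :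
    Quadric.basicOpen (xRatio a k) = (chart a).1 ⊓ pr1 ⁻¹ᵁ P1.chart k := by
  rw [xRatio, basicOpen_res, ← Scheme.preimage_basicOpen, P1.basicOpen_ratio,
    Scheme.Hom.preimage_inf, ← inf_assoc, inf_eq_left.mpr (chart_le_pr1 a)]

lemma basicOpen_zRatio (a : Fin 2 × Fin 2) (k : Fin 2) :
    Quadric.basicOpen (zRatio a k) = (chart a).1 ⊓ pr2 ⁻¹ᵁ P1.chart k := by
  rw [zRatio, basicOpen_res, ← Scheme.preimage_basicOpen, P1.basicOpen_ratio,
    Scheme.Hom.preimage_inf, ← inf_assoc, inf_eq_left.mpr (chart_le_pr2 a)]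

lemma chart₂_eq_basicOpen (a b : Fin 2 × Fin 2) :
    (chart₂ a b).1 = Quadric.basicOpen (xRatio a b.1 * zRatio a b.2) := by
  rw [Scheme.basicOpen_mul, basicOpen_xRatio, basicOpen_zRatio, ← inf_inf_distrib_left]
  rfl

lemma iSup_chart : ⨆ a, (chart a).1 = ⊤ := by
  refine top_le_iff.mp fun x _ ↦ ?_
  have h1 : pr1 x ∈ (⊤ : P1.Opens) := trivial
  have h2 : pr2 x ∈ (⊤ : P1.Opens) := trivial
  rw [← P1.iSup_chart, TopologicalSpace.Opens.mem_iSup] at h1 h2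
  obtain ⟨i, hi⟩ := h1
  obtain ⟨j, hj⟩ := h2
  exact TopologicalSpace.Opens.mem_iSup.mpr ⟨(i, j), hi, hj⟩

lemma const_eq_pr1 (a : Fin 2 × Fin 2) : const (chart a).1 =
    (P1.const a.1 ≫ pr1.appLE (P1.chart a.1) (chart a).1 (chart_le_pr1 a)).hom :=
  congr(((Scheme.ΓSpecIso (.of ℂ)).inv ≫ $((Scheme.Hom.appLE_comp_appLE pr1 P1.toSpec ⊤
    (P1.chart a.1) (chart a).1 le_top (chart_le_pr1 a)).symm)).hom)

lemma const_eq_pr2 (a : Fin 2 × Fin 2) : const (chart a).1 =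
    (P1.const a.2 ≫ pr2.appLE (P1.chart a.2) (chart a).1 (chart_le_pr2 a)).hom := by
  have h := Scheme.Hom.appLE_comp_appLE pr2 P1.toSpec ⊤ (P1.chart a.2) (chart a).1 le_top
    (chart_le_pr2 a)
  have h' : toSpec.appLE ⊤ (chart a).1 le_top =
      (pr2 ≫ P1.toSpec).appLE ⊤ (chart a).1 le_top := by
    simp only [toSpec, Limits.pullback.condition]
  exact congr(((Scheme.ΓSpecIso (.of ℂ)).inv ≫ $(h'.trans h.symm)).hom)

/-- The coordinate map `ℂ[s, t] → Γ(U_a)`. -/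
def chartEval (a : Fin 2 × Fin 2) : MvPolynomial (Fin 2) ℂ →+* Γ(Quadric, (chart a).1) :=
  MvPolynomial.eval₂Hom (const (chart a).1) ![xRatio a (1 - a.1), zRatio a (1 - a.2)]

lemma isPushout_chart (a : Fin 2 × Fin 2) :
    IsPushout (P1.toSpec.appLE ⊤ (P1.chart a.1) le_top) (P1.toSpec.appLE ⊤ (P1.chart a.2) le_top)
      (pr1.appLE (P1.chart a.1) (chart a).1 (chart_le_pr1 a))
      (pr2.appLE (P1.chart a.2) (chart a).1 (chart_le_pr2 a)) := by
  have H := IsPullback.of_hasPullback P1.toSpec P1.toSpec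
  have := isIso_pushoutSection_of_isAffineOpen H (US := ⊤) (UT := P1.chart a.2)
    (UX := P1.chart a.1) le_top le_top (UY := (chart a).1) rfl (isAffineOpen_top _)
    (Proj.isAffineOpen_basicOpen grading _ (X_mem_grading _) one_pos)
    (Proj.isAffineOpen_basicOpen grading _ (X_mem_grading _) one_pos)
  exact (isIso_pushoutSection_iff H ..).mp this

/-- Each chart is an affine plane: the sections form the pushout over `ℂ` of two polynomial rings in
one variable. The inverse `d` is given by the universal property of that pushout. -/
lemma chartEval_bijective (a : Fin 2 × Fin 2) : Function.Bijective (chartEval a) := by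
  have hne : ∀ i : Fin 2, i ≠ 1 - i := by decide
  let e₁ := RingEquiv.ofBijective _ (P1.chartEval_bijective (hne a.1))
  let e₂ := RingEquiv.ofBijective _ (P1.chartEval_bijective (hne a.2))
  let p₁ := pr1.appLE (P1.chart a.1) (chart a).1 (chart_le_pr1 a)
  let p₂ := pr2.appLE (P1.chart a.2) (chart a).1 (chart_le_pr2 a)
  let ι : Fin 2 → Polynomial ℂ →+* MvPolynomial (Fin 2) ℂ := fun i ↦
    Polynomial.eval₂RingHom MvPolynomial.C (MvPolynomial.X i)
  have hι₁ : p₁.hom.comp e₁.toRingHom = (chartEval a).comp (ι 0) := by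
    refine Polynomial.ringHom_ext (fun c ↦ ?_) ?_
    · simp [e₁, ι, P1.chartEval, chartEval, p₁, const_eq_pr1]
    · simp [e₁, ι, P1.chartEval, chartEval]
      rfl
  have hι₂ : p₂.hom.comp e₂.toRingHom = (chartEval a).comp (ι 1) := by
    refine Polynomial.ringHom_ext (fun c ↦ ?_) ?_
    · simp [e₂, ι, P1.chartEval, chartEval, p₂, const_eq_pr2]
    · simp [e₂, ι, P1.chartEval, chartEval]
      rfl
  let q₁ : Γ(P1, P1.chart a.1) ⟶ CommRingCat.of (MvPolynomial (Fin 2) ℂ) :=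
    CommRingCat.ofHom (R := Γ(P1, P1.chart a.1)) ((ι 0).comp e₁.symm.toRingHom)
  let q₂ : Γ(P1, P1.chart a.2) ⟶ CommRingCat.of (MvPolynomial (Fin 2) ℂ) :=
    CommRingCat.ofHom (R := Γ(P1, P1.chart a.2)) ((ι 1).comp e₂.symm.toRingHom)
  have hq : P1.toSpec.appLE ⊤ (P1.chart a.1) le_top ≫ q₁ =
      P1.toSpec.appLE ⊤ (P1.chart a.2) le_top ≫ q₂ := by
    rw [← cancel_epi (Scheme.ΓSpecIso (.of ℂ)).inv, ← Category.assoc, ← Category.assoc]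
    change P1.const a.1 ≫ q₁ = P1.const a.2 ≫ q₂
    ext c
    have h₁ : e₁ (Polynomial.C c) = (P1.const a.1).hom c := by simp [e₁, P1.chartEval]
    have h₂ : e₂ (Polynomial.C c) = (P1.const a.2).hom c := by simp [e₂, P1.chartEval]
    simp [q₁, q₂, ← h₁, ← h₂, ι]
  have H := isPushout_chart a
  let d := H.desc q₁ q₂ hq
  have hd₁ : ∀ x, d.hom (chartEval a (ι 0 x)) = ι 0 x := fun x ↦ by
    have h := congr($(H.inl_desc q₁ q₂ hq) (e₁ x))
    rw [← RingHom.comp_apply (chartEval a), ← hι₁]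
    refine h.trans ?_
    simp [q₁]
  have hd₂ : ∀ x, d.hom (chartEval a (ι 1 x)) = ι 1 x := fun x ↦ by
    have h := congr($(H.inr_desc q₁ q₂ hq) (e₂ x))
    rw [← RingHom.comp_apply (chartEval a), ← hι₂]
    refine h.trans ?_
    simp [q₂]
  have hd : d.hom.comp (chartEval a) = RingHom.id _ := by
    refine MvPolynomial.ringHom_ext (fun c ↦ ?_) (fun i ↦ ?_)
    · simpa [ι] using hd₁ (Polynomial.C c)
    · fin_cases i
      · simpa [ι] using hd₁ Polynomial.X
      · simpa [ι] using hd₂ Polynomial.X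
  have hd' : d ≫ CommRingCat.ofHom (chartEval a) = 𝟙 _ := by
    refine H.hom_ext ?_ ?_
    · ext x
      obtain ⟨y, rfl⟩ := e₁.surjective x
      have h := congr(chartEval a ($(H.inl_desc q₁ q₂ hq) (e₁ y)))
      refine h.trans ?_
      have h2 := congr($hι₁ y)
      simp only [RingHom.comp_apply] at h2
      simpa [q₁] using h2.symm
    · ext x
      obtain ⟨y, rfl⟩ := e₂.surjective x
      have h := congr(chartEval a ($(H.inr_desc q₁ q₂ hq) (e₂ y)))
      refine h.trans ?_
      have h2 := congr($hι₂ y)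
      simp only [RingHom.comp_apply] at h2
      simpa [q₂] using h2.symm
  exact Function.bijective_iff_has_inverse.mpr ⟨d.hom, fun x ↦ congr($hd x), fun x ↦ congr($hd' x)⟩

/-! ### Laurent monomials on the torus -/

instance algebraSections (U : Quadric.Opens) : Algebra ℂ Γ(Quadric, U) := (const U).toAlgebra

lemma algebraMap_eq_const (U : Quadric.Opens) (c : ℂ) :
    algebraMap ℂ Γ(Quadric, U) c = const U c := rfl

/-- Restriction of regular functions as a homomorphism of `ℂ`-algebras. -/
def resAlgHom {U V : Quadric.Opens} (h : U ≤ V) : Γ(Quadric, V) →ₐ[ℂ] Γ(Quadric, U) :=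
  { res h with commutes' := res_const h }

/-- The intersection of all the standard charts. -/
def torus : Quadric.Opens := (chart₂ (0, 0) (1, 1)).1

lemma torus_le_chart (a : Fin 2 × Fin 2) : torus ≤ (chart a).1 := by
  have h1 : torus ≤ pr1 ⁻¹ᵁ P1.chart a.1 := by
    obtain ⟨i, j⟩ := a
    fin_cases i
    · exact inf_le_left.trans (chart_le_pr1 (0, 0))
    · exact inf_le_right.trans (chart_le_pr1 (1, 1))
  have h2 : torus ≤ pr2 ⁻¹ᵁ P1.chart a.2 := by
    obtain ⟨i, j⟩ := a
    fin_cases j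
    · exact inf_le_left.trans (chart_le_pr2 (0, 0))
    · exact inf_le_right.trans (chart_le_pr2 (1, 1))
  exact le_inf h1 h2

lemma torus_le_chart₂ (a b : Fin 2 × Fin 2) : torus ≤ (chart₂ a b).1 :=
  le_inf (torus_le_chart a) (torus_le_chart b)

lemma torus_eq_chart₂ (a : Fin 2 × Fin 2) : torus = (chart₂ a (1 - a.1, 1 - a.2)).1 := by
  refine le_antisymm (torus_le_chart₂ _ _) ?_
  have h1 : ∀ i, (chart₂ a (1 - a.1, 1 - a.2)).1 ≤ pr1 ⁻¹ᵁ P1.chart i := fun i ↦ by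
    have hi : i = a.1 ∨ i = 1 - a.1 := by omega
    rcases hi with rfl | rfl
    · exact inf_le_left.trans (chart_le_pr1 a)
    · exact inf_le_right.trans (chart_le_pr1 (1 - a.1, 1 - a.2))
  have h2 : ∀ i, (chart₂ a (1 - a.1, 1 - a.2)).1 ≤ pr2 ⁻¹ᵁ P1.chart i := fun i ↦ by
    have hi : i = a.2 ∨ i = 1 - a.2 := by omega
    rcases hi with rfl | rfl
    · exact inf_le_left.trans (chart_le_pr2 a)
    · exact inf_le_right.trans (chart_le_pr2 (1 - a.1, 1 - a.2))
  exact le_inf (le_inf (h1 0) (h2 0)) (le_inf (h1 1) (h2 1))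

/-- The coordinate `x₁ / x₀` on the torus. -/
def torusX : Γ(Quadric, torus)ˣ where
  val := res (torus_le_chart (0, 0)) (xRatio (0, 0) 1)
  inv := res (torus_le_chart (1, 1)) (xRatio (1, 1) 0)
  val_inv := res_xRatio_mul (a := (0, 0)) (b := (1, 1)) _ _
  inv_val := res_xRatio_mul (a := (1, 1)) (b := (0, 0)) _ _

/-- The coordinate `z₁ / z₀` on the torus. -/
def torusZ : Γ(Quadric, torus)ˣ where
  val := res (torus_le_chart (0, 0)) (zRatio (0, 0) 1)
  inv := res (torus_le_chart (1, 1)) (zRatio (1, 1) 0)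
  val_inv := res_zRatio_mul (a := (0, 0)) (b := (1, 1)) _ _
  inv_val := res_zRatio_mul (a := (1, 1)) (b := (0, 0)) _ _

/-- The Laurent monomials. -/
def laurent (e : ℤ × ℤ) : Γ(Quadric, torus) := ↑(torusX ^ e.1 * torusZ ^ e.2)

lemma laurent_add (e f : ℤ × ℤ) : laurent (e + f) = laurent e * laurent f := by
  simp only [laurent, Prod.fst_add, Prod.snd_add, zpow_add, ← Units.val_mul]
  congr 1
  exact mul_mul_mul_comm _ _ _ _

@[simp] lemma laurent_zero : laurent 0 = 1 := by simp [laurent]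

lemma laurent_neg_mul (e : ℤ × ℤ) (f : Γ(Quadric, torus)) :
    laurent (-e) * (laurent e * f) = f := by
  rw [← mul_assoc, ← laurent_add, neg_add_cancel, laurent_zero, one_mul]

lemma laurent_nsmul (N : ℕ) (e : ℤ × ℤ) : laurent (N • e) = laurent e ^ N := by
  induction N with
  | zero => simp
  | succ N ih => rw [succ_nsmul, laurent_add, ih, pow_succ]

lemma res_xRatio_torus (a : Fin 2 × Fin 2) (k : Fin 2) :
    res (torus_le_chart a) (xRatio a k) = laurent ((k : ℤ) - (a.1 : ℤ), 0) := by
  have h0 : ∀ k : Fin 2, res (torus_le_chart (0, 0)) (xRatio (0, 0) k) = laurent ((k : ℤ), 0) := by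
    intro k
    fin_cases k
    · simpa [laurent] using congrArg (res (torus_le_chart (0, 0))) (xRatio_self (0, 0))
    · simp [laurent]
      rfl
  have h := res_xRatio (a := (0, 0)) (b := a) k (torus_le_chart (0, 0)) (torus_le_chart a)
  rw [h0, h0] at h
  rw [← laurent_neg_mul ((a.1 : ℤ), 0) (res _ _), ← h, ← laurent_add]
  congr 1
  ext <;> simp; ring

lemma res_zRatio_torus (a : Fin 2 × Fin 2) (k : Fin 2) :
    res (torus_le_chart a) (zRatio a k) = laurent (0, (k : ℤ) - (a.2 : ℤ)) := by
  have h0 : ∀ k : Fin 2, res (torus_le_chart (0, 0)) (zRatio (0, 0) k) = laurent (0, (k : ℤ)) := by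
    intro k
    fin_cases k
    · simpa [laurent] using congrArg (res (torus_le_chart (0, 0))) (zRatio_self (0, 0))
    · simp [laurent]
      rfl
  have h := res_zRatio (a := (0, 0)) (b := a) k (torus_le_chart (0, 0)) (torus_le_chart a)
  rw [h0, h0] at h
  rw [← laurent_neg_mul (0, (a.2 : ℤ)) (res _ _), ← h, ← laurent_add]
  congr 1
  ext <;> simp; ring

/-- The weight of the chart `U_a` in the trivializations of `𝒪(m, n)`. -/
def weight (m n : ℤ) (a : Fin 2 × Fin 2) : ℤ × ℤ := (m * (a.1 : ℤ), n * (a.2 : ℤ))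

lemma res_transition (m n : ℤ) (a b : Fin 2 × Fin 2) :
    res (torus_le_chart₂ a b) (transition m n a b) = laurent (weight m n b - weight m n a) := by
  simp only [transition, map_mul, map_pow, res_res, res_xRatio_torus, res_zRatio_torus]
  simp only [← laurent_nsmul, ← laurent_add]
  congr 1
  have hm : ((m.toNat : ℕ) : ℤ) - ((-m).toNat : ℕ) = m := by omega
  have hn : ((n.toNat : ℕ) : ℤ) - ((-n).toNat : ℕ) = n := by omega
  ext
  · simp only [weight, Prod.fst_add, Prod.smul_fst, Prod.fst_sub]
    simp only [nsmul_eq_mul]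
    conv_rhs => rw [← hm]
    ring
  · simp only [weight, Prod.snd_add, Prod.smul_snd, Prod.snd_sub]
    simp only [nsmul_eq_mul]
    conv_rhs => rw [← hn]
    ring

/-- `t ^ e` is regular where the coordinates `i` and `i'` of `ℙ¹` do not vanish. -/
def Regular₁ (i i' : Fin 2) (e : ℤ) : Prop :=
  (i = 1 ∨ i' = 1 ∨ 0 ≤ e) ∧ (i = 0 ∨ i' = 0 ∨ e ≤ 0)

/-- The exponents of the Laurent monomials that are regular on `U_a ∩ U_b`. -/
def regular (a b : Fin 2 × Fin 2) : Set (ℤ × ℤ) :=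
  {e | Regular₁ a.1 b.1 e.1 ∧ Regular₁ a.2 b.2 e.2}

lemma res_chartEval_monomial (a : Fin 2 × Fin 2) (d : Fin 2 →₀ ℕ) (c : ℂ) :
    res (torus_le_chart a) (chartEval a (MvPolynomial.monomial d c)) =
      c • laurent ((1 - 2 * (a.1 : ℤ)) * d 0, (1 - 2 * (a.2 : ℤ)) * d 1) := by
  have hk : ∀ i : Fin 2, ((1 - i : Fin 2) : ℤ) - (i : ℤ) = 1 - 2 * (i : ℤ) := by decide
  simp only [chartEval, MvPolynomial.coe_eval₂Hom, MvPolynomial.eval₂_monomial, map_mul, res_const,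
    Finsupp.prod_fintype, pow_zero, implies_true, Fin.prod_univ_two, Matrix.cons_val_zero,
    Matrix.cons_val_one, map_pow, res_xRatio_torus, res_zRatio_torus, ← laurent_nsmul,
    ← laurent_add, Algebra.smul_def, algebraMap_eq_const, hk]
  congr 2
  ext <;> simp <;> ring

lemma res_mem_span (a : Fin 2 × Fin 2) (f : Γ(Quadric, (chart a).1)) :
    res (torus_le_chart a) f ∈ Submodule.span ℂ (laurent '' regular a a) := by
  obtain ⟨p, rfl⟩ := (chartEval_bijective a).2 f
  induction p using MvPolynomial.induction_on' with
  | monomial d c =>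
    rw [res_chartEval_monomial]
    refine Submodule.smul_mem _ _ (Submodule.subset_span ⟨_, ?_, rfl⟩)
    obtain ⟨i, j⟩ := a
    fin_cases i <;> fin_cases j <;> simp [regular, Regular₁]
  | add p q hp hq => rw [map_add, map_add]; exact add_mem hp hq

lemma exists_res_eq_laurent (a : Fin 2 × Fin 2) {e : ℤ × ℤ} (he : e ∈ regular a a) :
    ∃ f, res (torus_le_chart a) f = laurent e := by
  refine ⟨chartEval a (MvPolynomial.monomial
    (Finsupp.equivFunOnFinite.symm ![e.1.natAbs, e.2.natAbs]) 1), ?_⟩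
  rw [res_chartEval_monomial, one_smul]
  congr 1
  obtain ⟨i, j⟩ := a
  obtain ⟨e₁, e₂⟩ := e
  fin_cases i <;> fin_cases j <;> simp [regular, Regular₁, -Nat.cast_natAbs] at he ⊢ <;> omega

lemma exists_res_eq_of_mem_span (a : Fin 2 × Fin 2) {g : Γ(Quadric, torus)}
    (hg : g ∈ Submodule.span ℂ (laurent '' regular a a)) :
    ∃ f, res (torus_le_chart a) f = g := by
  have : Submodule.span ℂ (laurent '' regular a a) ≤
      LinearMap.range (resAlgHom (torus_le_chart a)).toLinearMap := by
    rw [Submodule.span_le]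
    rintro _ ⟨e, he, rfl⟩
    exact exists_res_eq_laurent a he
  exact this hg

/-- Functions on `U_a ∩ U_b` extend to `U_a` after multiplication by a monomial. -/
lemma exists_mul_pow_eq_res (a b : Fin 2 × Fin 2) (f : Γ(Quadric, (chart₂ a b).1)) :
    ∃ (N : ℕ) (g : Γ(Quadric, (chart a).1)),
      f * res (chart₂_le_left a b) (xRatio a b.1 * zRatio a b.2) ^ N =
        res (chart₂_le_left a b) g := by
  let := (res (chart₂_le_left a b)).toAlgebra
  have : IsLocalization.Away (xRatio a b.1 * zRatio a b.2) Γ(Quadric, (chart₂ a b).1) :=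
    (chart a).2.isLocalization_of_eq_basicOpen _ (homOfLE (chart₂_le_left a b))
      (chart₂_eq_basicOpen a b)
  obtain ⟨⟨g, ⟨_, N, rfl⟩⟩, h⟩ :=
    IsLocalization.surj (Submonoid.powers (xRatio a b.1 * zRatio a b.2)) f
  exact ⟨N, g, by rw [← map_pow]; exact h⟩

lemma res_ratio_mul_torus (a b : Fin 2 × Fin 2) :
    res (torus_le_chart a) (xRatio a b.1 * zRatio a b.2) =
      laurent ((b.1 : ℤ) - (a.1 : ℤ), (b.2 : ℤ) - (a.2 : ℤ)) := by
  rw [map_mul, res_xRatio_torus, res_zRatio_torus, ← laurent_add]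
  simp

lemma laurent_mul_mem_span {S S' : Set (ℤ × ℤ)} {d : ℤ × ℤ} (h : ∀ e ∈ S, d + e ∈ S')
    {f : Γ(Quadric, torus)} (hf : f ∈ Submodule.span ℂ (laurent '' S)) :
    laurent d * f ∈ Submodule.span ℂ (laurent '' S') := by
  induction hf using Submodule.span_induction with
  | mem x hx =>
    obtain ⟨e, he, rfl⟩ := hx
    exact Submodule.subset_span ⟨_, h e he, laurent_add _ _⟩
  | zero => simp
  | add x y _ _ hx hy => rw [mul_add]; exact add_mem hx hy
  | smul c x _ hx => rw [mul_smul_comm]; exact Submodule.smul_mem _ _ hx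

/-- After multiplication by a power of the equation of the overlap, `f` extends to `U_a`. Dividing
again shifts exponents only in the directions where `a` and `b` differ, and there `regular a b`
imposes no sign condition. -/
lemma res_mem_span₂ (a b : Fin 2 × Fin 2) (f : Γ(Quadric, (chart₂ a b).1)) :
    res (torus_le_chart₂ a b) f ∈ Submodule.span ℂ (laurent '' regular a b) := by
  obtain ⟨N, g, h⟩ := exists_mul_pow_eq_res a b f
  have h2 := congrArg (res (torus_le_chart₂ a b)) h
  rw [map_mul, map_pow, res_res, res_res, res_ratio_mul_torus, ← laurent_nsmul, mul_comm] at h2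
  rw [← laurent_neg_mul _ (res (torus_le_chart₂ a b) f), h2]
  refine laurent_mul_mem_span ?_ (res_mem_span a g)
  rintro ⟨e₁, e₂⟩ ⟨h₁, h₂⟩
  obtain ⟨i, j⟩ := a
  obtain ⟨i', j'⟩ := b
  fin_cases i <;> fin_cases j <;> fin_cases i' <;> fin_cases j' <;>
    simp [regular, Regular₁] at h₁ h₂ ⊢ <;> omega

lemma res_torus_injective (a : Fin 2 × Fin 2) : Function.Injective (res (torus_le_chart a)) := by
  let := (res (torus_le_chart a)).toAlgebra
  have hloc : IsLocalization.Away (xRatio a (1 - a.1) * zRatio a (1 - a.2)) Γ(Quadric, torus) :=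
    (chart a).2.isLocalization_of_eq_basicOpen _ (homOfLE (torus_le_chart a))
      ((torus_eq_chart₂ a).trans (chart₂_eq_basicOpen a _))
  have hdom : IsDomain Γ(Quadric, (chart a).1) :=
    (RingEquiv.ofBijective _ (chartEval_bijective a)).isDomain_iff.mp inferInstance
  have hne : xRatio a (1 - a.1) * zRatio a (1 - a.2) ≠ 0 := by
    have : xRatio a (1 - a.1) * zRatio a (1 - a.2) =
      chartEval a (MvPolynomial.X 0 * MvPolynomial.X 1) := by simp [chartEval]
    rw [this, Ne, map_eq_zero_iff _ (chartEval_bijective a).1]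
    simp
  exact IsLocalization.injective Γ(Quadric, torus) (powers_le_nonZeroDivisors_of_noZeroDivisors hne)

lemma res_torus_injective₂ (a b : Fin 2 × Fin 2) :
    Function.Injective (res (torus_le_chart₂ a b)) := by
  refine (injective_iff_map_eq_zero _).mpr fun f hf ↦ ?_
  obtain ⟨N, g, h⟩ := exists_mul_pow_eq_res a b f
  have h2 := congrArg (res (torus_le_chart₂ a b)) h
  rw [map_mul, hf, zero_mul, res_res] at h2
  have hg : g = 0 := res_torus_injective a (by rw [← h2, map_zero])
  rw [hg, map_zero] at h
  have hu : IsUnit (res (chart₂_le_left a b) (xRatio a b.1 * zRatio a b.2)) := by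
    rw [map_mul]
    exact (IsUnit.of_mul_eq_one _ (res_xRatio_mul _ (chart₂_le_right a b))).mul
      (IsUnit.of_mul_eq_one _ (res_zRatio_mul _ (chart₂_le_right a b)))
  exact (hu.pow N).mul_left_eq_zero.mp h

/-- Multiplying a finite relation by `laurent (N, N)` with `N` large makes all exponents
nonnegative, so it becomes a relation between distinct monomials of the polynomial ring of the chart
`(0, 0)`. -/
lemma linearIndependent_laurent : LinearIndependent ℂ laurent := by
  rw [linearIndependent_iff']
  intro s g hg e₀ he₀
  obtain ⟨N, hN⟩ : ∃ N : ℕ, ∀ e ∈ s, 0 ≤ (N : ℤ) + e.1 ∧ 0 ≤ (N : ℤ) + e.2 := by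
    refine ⟨∑ e ∈ s, (e.1.natAbs + e.2.natAbs), fun e he ↦ ?_⟩
    have := Finset.single_le_sum (f := fun e : ℤ × ℤ ↦ e.1.natAbs + e.2.natAbs)
      (fun _ _ ↦ Nat.zero_le _) he
    generalize ∑ e ∈ s, (e.1.natAbs + e.2.natAbs) = N at this ⊢
    omega
  let d : ℤ × ℤ → (Fin 2 →₀ ℕ) := fun e ↦
    Finsupp.equivFunOnFinite.symm ![((N : ℤ) + e.1).toNat, ((N : ℤ) + e.2).toNat]
  have hd : ∀ e ∈ s, ∀ c : ℂ, res (torus_le_chart (0, 0)) (chartEval (0, 0)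
      (MvPolynomial.monomial (d e) c)) = c • (laurent (N, N) * laurent e) := fun e he c ↦ by
    rw [res_chartEval_monomial, ← laurent_add]
    congr 2
    obtain ⟨h1, h2⟩ := hN e he
    ext <;> simp [d] <;> omega
  have h0 : res (torus_le_chart (0, 0)) (chartEval (0, 0)
      (∑ e ∈ s, MvPolynomial.monomial (d e) (g e))) = 0 := by
    rw [map_sum, map_sum, Finset.sum_congr rfl fun e he ↦ hd e he (g e)]
    simp_rw [← mul_smul_comm, ← Finset.mul_sum, hg, mul_zero]
  rw [map_eq_zero_iff _ (res_torus_injective _), map_eq_zero_iff _ (chartEval_bijective _).1] at h0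
  have h1 := congrArg (MvPolynomial.coeff (d e₀)) h0
  rw [MvPolynomial.coeff_sum, Finset.sum_eq_single e₀] at h1
  · simpa using h1
  · intro e he hne
    rw [MvPolynomial.coeff_monomial, if_neg]
    intro h
    apply hne
    have h1 := DFunLike.congr_fun h 0
    have h2 := DFunLike.congr_fun h 1
    obtain ⟨h3, h4⟩ := hN e he
    obtain ⟨h5, h6⟩ := hN e₀ he₀
    simp [d] at h1 h2
    ext <;> omega
  · exact fun h ↦ absurd he₀ h

/-- The Laurent monomials form a basis of the ring of functions on the torus. -/
def laurentBasis : Module.Basis (ℤ × ℤ) ℂ Γ(Quadric, torus) :=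
  Module.Basis.mk linearIndependent_laurent (by
    intro f _
    have h := res_mem_span₂ (0, 0) (1, 1) f
    rw [show res (torus_le_chart₂ (0, 0) (1, 1)) f = f from res_self (le_refl torus) f] at h
    exact Submodule.span_mono (Set.image_subset_range _ _) h)

@[simp] lemma laurentBasis_apply (e : ℤ × ℤ) : laurentBasis e = laurent e := by
  simp [laurentBasis]

/-! ### Vanishing of `H¹(𝒪(m, n))` -/

/-- The chart used to contract the part of degree `e` of the Čech complex. -/
def pole (e : ℤ × ℤ) : Fin 2 × Fin 2 := (if e.1 < 0 then 0 else 1, if e.2 < 0 then 0 else 1)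

/-- The projection to the span of the monomials with `pole e = k`. -/
def poleProj (k : Fin 2 × Fin 2) : Γ(Quadric, torus) →ₗ[ℂ] Γ(Quadric, torus) :=
  laurentBasis.constr ℂ fun e ↦ if pole e = k then laurent e else 0

lemma poleProj_laurent (k : Fin 2 × Fin 2) (e : ℤ × ℤ) :
    poleProj k (laurent e) = if pole e = k then laurent e else 0 := by
  have := laurentBasis.constr_basis ℂ (fun e ↦ if pole e = k then laurent e else 0) e
  rwa [laurentBasis_apply] at this

lemma sum_poleProj (f : Γ(Quadric, torus)) : ∑ k, poleProj k f = f := by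
  have : ∑ k, poleProj k = LinearMap.id := by
    refine laurentBasis.ext fun e ↦ ?_
    rw [LinearMap.sum_apply, laurentBasis_apply]
    simp [poleProj_laurent]
  simpa using congr($this f)

/-- Relative to `x₀ ^ m`, the exponent is `E = m i + e`; regularity on `U_0` means `0 ≤ E`, on `U_1`
it means `E ≤ m`. The chart `i` selected by the sign of `E` is opposite to one where the monomial is
already regular: `U_0` if `0 ≤ E`, and `U_1` if `E < 0`, since then `E ≤ -1 ≤ m`. So regularity on
`U_i ∩ U_i'` forces regularity on `U_i'`. This is where `-1 ≤ m` enters. -/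
lemma regular₁_of_pole {i i' : Fin 2} {m e : ℤ} (hm : -1 ≤ m) (he : Regular₁ i i' e)
    (h : (if m * (i : ℤ) + e < 0 then (0 : Fin 2) else 1) = i) :
    Regular₁ i' i' (-(m * (i' : ℤ)) + (m * (i : ℤ) + e)) := by
  fin_cases i <;> fin_cases i' <;> simp [Regular₁] at he h ⊢ <;> omega

lemma poleProj_mem_span {m n : ℤ} (hm : -1 ≤ m) (hn : -1 ≤ n) (k a : Fin 2 × Fin 2)
    {f : Γ(Quadric, torus)} (hf : f ∈ Submodule.span ℂ (laurent '' regular k a)) :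
    laurent (-weight m n a) * poleProj k (laurent (weight m n k) * f) ∈
      Submodule.span ℂ (laurent '' regular a a) := by
  induction hf using Submodule.span_induction with
  | mem x hx =>
    obtain ⟨e, he, rfl⟩ := hx
    rw [← laurent_add, poleProj_laurent]
    split_ifs with h
    · rw [← laurent_add]
      refine Submodule.subset_span ⟨_, ?_, rfl⟩
      exact ⟨regular₁_of_pole hm he.1 congr($(h).1), regular₁_of_pole hn he.2 congr($(h).2)⟩
    · simp
  | zero => simp
  | add x y _ _ hx hy => rw [mul_add, map_add, mul_add]; exact add_mem hx hy
  | smul c x _ hx =>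
    rw [mul_smul_comm, map_smul, mul_smul_comm]
    exact Submodule.smul_mem _ _ hx

/-- Every Čech `1`-cocycle of `𝒪(m, n)`, `m, n ≥ -1`, is a coboundary. -/
theorem exists_cochain_of_cocycle {m n : ℤ} (hm : -1 ≤ m) (hn : -1 ≤ n)
    (g : ∀ a b, Γ(Quadric, (chart₂ a b).1))
    (hg : ∀ a b c, res (chart₃_le₁₂ a b c) (transition m n a b) * res (chart₃_le₂₃ a b c) (g b c) -
      res (chart₃_le₁₃ a b c) (g a c) + res (chart₃_le₁₂ a b c) (g a b) = 0) :
    ∃ h : ∀ a, Γ(Quadric, (chart a).1), ∀ a b,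
      transition m n a b * res (chart₂_le_right a b) (h b) - res (chart₂_le_left a b) (h a) =
        g a b := by
  -- On the torus all coefficients are rewritten relative to the single generator `x₀ ^ m z₀ ^ n`,
  -- so the transition functions disappear from the cocycle condition.
  let G : ∀ a b, Γ(Quadric, torus) := fun a b ↦
    laurent (weight m n a) * res (torus_le_chart₂ a b) (g a b)
  have hG : ∀ a b c, G b c - G a c = - G a b := fun a b c ↦ by
    have hle : torus ≤ (chart₃ a b c).1 := le_inf (torus_le_chart₂ a b) (torus_le_chart c)
    have h := congrArg (fun x ↦ laurent (weight m n a) * res hle x) (hg a b c)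
    simp only [map_add, map_sub, map_mul, res_res, res_transition, map_zero, mul_zero] at h
    have h2 : laurent (weight m n b) =
      laurent (weight m n a) * laurent (weight m n b - weight m n a) := by
      rw [← laurent_add]
      congr 1
      abel
    simp only [G, h2]
    linear_combination h
  -- The contracting homotopy: in each degree `e` the cocycle is evaluated against the fixed chart
  -- `pole e`. The cocycle identity for `(k, a, b)` gives `G k b - G k a = G a b`, and summing the
  -- projections recovers `G a b`.
  let H : ∀ a, Γ(Quadric, torus) := fun a ↦ ∑ k, poleProj k (G k a)
  have hH : ∀ a, laurent (-weight m n a) * H a ∈ Submodule.span ℂ (laurent '' regular a a) := by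
    intro a
    rw [Finset.mul_sum]
    exact Submodule.sum_mem _ fun k _ ↦ poleProj_mem_span hm hn k a (res_mem_span₂ k a _)
  choose h hh using fun a ↦ exists_res_eq_of_mem_span a (hH a)
  refine ⟨h, fun a b ↦ res_torus_injective₂ a b ?_⟩
  rw [map_sub, map_mul, res_res, res_res, res_transition, hh, hh, ← mul_assoc, ← laurent_add]
  have hHG : H b - H a = G a b := by
    rw [← sum_poleProj (G a b), ← Finset.sum_sub_distrib]
    refine Finset.sum_congr rfl fun k _ ↦ ?_
    rw [← map_sub]
    congr 1
    linear_combination - hG k a b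
  rw [show weight m n b - weight m n a + -weight m n b = -weight m n a by abel, ← mul_sub, hHG,
    laurent_neg_mul]

/-! ### Sections on basic opens -/

section BasicOpen

variable {X : Scheme.{0}} {U V : X.Opens} {g : Γ(X, U)}

lemma exists_mul_pow_eq_map (hU : IsAffineOpen U) (i : V ⟶ U) (e : V = X.basicOpen g)
    (f : Γ(X, V)) :
    ∃ (N : ℕ) (f' : Γ(X, U)), f * X.presheaf.map i.op g ^ N = X.presheaf.map i.op f' := by
  let := (X.presheaf.map i.op).hom.toAlgebra
  have : IsLocalization.Away g Γ(X, V) := hU.isLocalization_of_eq_basicOpen _ i e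
  obtain ⟨⟨f', ⟨_, N, rfl⟩⟩, h⟩ := IsLocalization.surj (Submonoid.powers g) f
  exact ⟨N, f', by rw [← map_pow]; exact h⟩

lemma exists_pow_mul_eq_zero (hU : IsAffineOpen U) (i : V ⟶ U) (e : V = X.basicOpen g)
    (f : Γ(X, U)) (hf : X.presheaf.map i.op f = 0) : ∃ N : ℕ, g ^ N * f = 0 := by
  let := (X.presheaf.map i.op).hom.toAlgebra
  have : IsLocalization.Away g Γ(X, V) := hU.isLocalization_of_eq_basicOpen _ i e
  obtain ⟨⟨_, N, rfl⟩, h⟩ := (IsLocalization.map_eq_zero_iff (Submonoid.powers g) Γ(X, V) f).mp hf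
  exact ⟨N, h⟩

end BasicOpen

/-! ### Effective divisors given by local equations -/

/-- The ideal of functions on `U` that are locally multiples of the equations `L a`. -/
def localIdeal (L : ∀ a, Γ(Quadric, (chart a).1)) (U : Quadric.affineOpens) :
    Ideal Γ(Quadric, U.1) :=
  ⨅ a, (Ideal.span {res (inf_le_right : U.1 ⊓ (chart a).1 ≤ _) (L a)}).comap
    (res (inf_le_left : U.1 ⊓ (chart a).1 ≤ _))

lemma mem_localIdeal {L : ∀ a, Γ(Quadric, (chart a).1)} {U : Quadric.affineOpens}
    {f : Γ(Quadric, U.1)} : f ∈ localIdeal L U ↔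
      ∀ a, ∃ c, res (inf_le_left : U.1 ⊓ (chart a).1 ≤ _) f =
        res (inf_le_right : U.1 ⊓ (chart a).1 ≤ _) (L a) * c := by
  simp only [localIdeal, Ideal.mem_iInf, Ideal.mem_comap, Ideal.mem_span_singleton]
  rfl

/-- On each affine open `U ∩ U_a`, one power of `g` clears the denominator of the cofactor and
another turns the equality after localization into an equality. Finitely many charts then allow a
common exponent. -/
lemma exists_pow_mul_mem_localIdeal (L : ∀ a, Γ(Quadric, (chart a).1)) (U : Quadric.affineOpens)
    (g f : Γ(Quadric, U.1)) (hf : res (Quadric.basicOpen_le g) f ∈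
      localIdeal L (Quadric.affineBasicOpen g)) : ∃ N : ℕ, g ^ N * f ∈ localIdeal L U := by
  have key : ∀ a, ∃ N : ℕ, ∃ c, res (inf_le_left : U.1 ⊓ (chart a).1 ≤ _) (g ^ N * f) =
        res (inf_le_right : U.1 ⊓ (chart a).1 ≤ _) (L a) * c := by
    intro a
    have hV : IsAffineOpen (U.1 ⊓ (chart a).1) := U.2.inf (chart a).2
    have hle : Quadric.basicOpen g ⊓ (chart a).1 ≤ U.1 ⊓ (chart a).1 :=
      inf_le_inf_right _ (Quadric.basicOpen_le g)
    obtain ⟨c', hc'⟩ : ∃ c' : Γ(Quadric, Quadric.basicOpen g ⊓ (chart a).1),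
        res (hle.trans inf_le_left) f = res (hle.trans inf_le_right) (L a) * c' := by
      obtain ⟨c', hc'⟩ := mem_localIdeal.mp hf a
      exact ⟨c', (res_res _ _ _).symm.trans hc'⟩
    have he : Quadric.basicOpen g ⊓ (chart a).1 =
        Quadric.basicOpen (res (inf_le_left : U.1 ⊓ (chart a).1 ≤ _) g) := by
      rw [basicOpen_res, inf_right_comm, inf_eq_right.mpr (Quadric.basicOpen_le g)]
    obtain ⟨K, c, hc⟩ := exists_mul_pow_eq_map hV (homOfLE hle) he c'
    change c' * res hle _ ^ K = res hle c at hc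
    rw [res_res] at hc
    obtain ⟨K', hK'⟩ := exists_pow_mul_eq_zero hV (homOfLE hle) he
      (res inf_le_left (g ^ K * f) - res inf_le_right (L a) * c) (by
        change res hle _ = 0
        simp only [map_sub, map_mul, map_pow, res_res]
        rw [← hc, hc']
        ring)
    refine ⟨K' + K, res inf_le_left g ^ K' * c, ?_⟩
    simp only [map_mul, map_pow] at hK' ⊢
    linear_combination hK'
  choose N c hc using key
  refine ⟨∑ a, N a, mem_localIdeal.mpr fun a ↦ ?_⟩
  refine ⟨res inf_le_left g ^ (∑ b ∈ Finset.univ.erase a, N b) * c a, ?_⟩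
  rw [← Finset.sum_erase_add _ _ (Finset.mem_univ a), pow_add, mul_assoc, map_mul, hc, map_pow]
  ring

/-- The effective divisor with local equations `L a`. -/
def divisor (L : ∀ a, Γ(Quadric, (chart a).1)) : Quadric.IdealSheafData where
  ideal := localIdeal L
  map_ideal_basicOpen U g := by
    apply le_antisymm
    · refine Ideal.map_le_iff_le_comap.mpr fun f hf ↦ ?_
      refine mem_localIdeal.mpr fun a ↦ ?_
      obtain ⟨c, hc⟩ := mem_localIdeal.mp hf a
      have hle : Quadric.basicOpen g ⊓ (chart a).1 ≤ U.1 ⊓ (chart a).1 :=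
        inf_le_inf_right _ (Quadric.basicOpen_le g)
      refine ⟨res hle c, ?_⟩
      have := congrArg (res hle) hc
      rw [map_mul, res_res, res_res] at this
      exact (res_res _ _ _).trans this
    -- Clear the denominator of `h`, then multiply by a further power of `g` to land in the ideal on
    -- `U`. Both powers are units on the basic open set.
    · intro h hh
      obtain ⟨N, f, hf⟩ := exists_mul_pow_eq_map U.2 (homOfLE (Quadric.basicOpen_le g)) rfl h
      obtain ⟨M, hM⟩ := exists_pow_mul_mem_localIdeal L U g f (by
        change Quadric.presheaf.map (homOfLE (Quadric.basicOpen_le g)).op f ∈ _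
        rw [← hf, mul_comm]
        exact Ideal.mul_mem_left _ _ hh)
      have hu : IsUnit (Quadric.presheaf.map (homOfLE (Quadric.basicOpen_le g)).op g) :=
        RingedSpace.isUnit_res_basicOpen _ g
      have h2 := Ideal.mem_map_of_mem
        (Quadric.presheaf.map (homOfLE (Quadric.basicOpen_le g)).op).hom hM
      rw [map_mul, map_pow, ← hf, mul_comm h, ← mul_assoc, ← pow_add] at h2
      exact (Ideal.unit_mul_mem_iff_mem _ (hu.pow (M + N))).mp h2

/-- On `U_a` the condition for the index `a` itself is divisibility by `L a`; the compatibility `hL`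
supplies the conditions for the other charts. -/
lemma divisor_ideal_chart (L : ∀ a, Γ(Quadric, (chart a).1))
    (hL : ∀ a b, ∃ c, res (chart₂_le_left a b) (L a) = res (chart₂_le_right a b) (L b) * c)
    (a : Fin 2 × Fin 2) : (divisor L).ideal (chart a) = Ideal.span {L a} := by
  apply le_antisymm
  · intro f hf
    obtain ⟨c, hc⟩ := mem_localIdeal.mp hf a
    have hle : (chart a).1 ≤ (chart a).1 ⊓ (chart a).1 := le_inf le_rfl le_rfl
    have h := congrArg (res hle) hc
    rw [map_mul, res_res, res_res, res_self, res_self] at h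
    exact Ideal.mem_span_singleton.mpr ⟨_, h⟩
  · rw [Ideal.span_singleton_le_iff_mem]
    exact mem_localIdeal.mpr fun b ↦ hL a b

/-! ### Lines -/

/-- The form `p x₀ + q x₁` on the chart `U_a`. -/
def xForm (p q : ℂ) (a : Fin 2 × Fin 2) : Γ(Quadric, (chart a).1) :=
  const _ p * xRatio a 0 + const _ q * xRatio a 1

/-- The form `p z₀ + q z₁` on the chart `U_a`. -/
def zForm (p q : ℂ) (a : Fin 2 × Fin 2) : Γ(Quadric, (chart a).1) :=
  const _ p * zRatio a 0 + const _ q * zRatio a 1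

lemma res_xForm (p q : ℂ) {a b : Fin 2 × Fin 2} {U : Quadric.Opens} (ha : U ≤ (chart a).1)
    (hb : U ≤ (chart b).1) :
    res ha (xForm p q a) = res ha (xRatio a b.1) * res hb (xForm p q b) := by
  simp only [xForm, map_add, map_mul, res_const]
  rw [res_xRatio 0 ha hb, res_xRatio 1 ha hb]
  ring

lemma res_zForm (p q : ℂ) {a b : Fin 2 × Fin 2} {U : Quadric.Opens} (ha : U ≤ (chart a).1)
    (hb : U ≤ (chart b).1) :
    res ha (zForm p q a) = res ha (zRatio a b.2) * res hb (zForm p q b) := by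
  simp only [zForm, map_add, map_mul, res_const]
  rw [res_zRatio 0 ha hb, res_zRatio 1 ha hb]
  ring

lemma divisor_xForm_ideal (p q : ℂ) (a : Fin 2 × Fin 2) :
    (divisor (xForm p q)).ideal (chart a) = Ideal.span {xForm p q a} :=
  divisor_ideal_chart _ (fun _ _ ↦ ⟨_, (res_xForm p q _ _).trans (mul_comm _ _)⟩) a

lemma divisor_zForm_ideal (p q : ℂ) (a : Fin 2 × Fin 2) :
    (divisor (zForm p q)).ideal (chart a) = Ideal.span {zForm p q a} :=
  divisor_ideal_chart _ (fun _ _ ↦ ⟨_, (res_zForm p q _ _).trans (mul_comm _ _)⟩) a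

open MvPolynomial in
lemma linear_ne_zero {σ : Type*} {i j : σ} (hij : i ≠ j) {p q : ℂ} (h : p ≠ 0 ∨ q ≠ 0) :
    (C p * X i + C q * X j : MvPolynomial σ ℂ) ≠ 0 := by
  classical
  intro h0
  have h1 := congrArg (coeff (Finsupp.single i 1)) h0
  have h2 := congrArg (coeff (Finsupp.single j 1)) h0
  simp [coeff_C_mul, coeff_X, Finsupp.single_left_inj, hij, hij.symm] at h1 h2
  tauto

open MvPolynomial in
lemma isCurve_divisor_xForm {p q : ℂ} (h : p ≠ 0 ∨ q ≠ 0) :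
    IsCurve 1 0 (divisor (xForm p q)) := by
  refine ⟨C p * X (.inl 0) + C q * X (.inl 1), linear_ne_zero (by simp) h, ?_, fun a ↦ ?_⟩
  · refine Submodule.add_mem (weightedHomogeneousSubmodule ℂ _ _) ?_ ?_ <;>
    · rw [mem_weightedHomogeneousSubmodule, ← zero_add ((1, 0) : ℕ × ℕ)]
      exact (isWeightedHomogeneous_C _ _).mul (isWeightedHomogeneous_X _ _ _)
  · rw [divisor_xForm_ideal]
    simp [dehomogenize, xForm]

open MvPolynomial in
lemma isCurve_divisor_zForm {p q : ℂ} (h : p ≠ 0 ∨ q ≠ 0) :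
    IsCurve 0 1 (divisor (zForm p q)) := by
  refine ⟨C p * X (.inr 0) + C q * X (.inr 1), linear_ne_zero (by simp) h, ?_, fun a ↦ ?_⟩
  · refine Submodule.add_mem (weightedHomogeneousSubmodule ℂ _ _) ?_ ?_ <;>
    · rw [mem_weightedHomogeneousSubmodule, ← zero_add ((0, 1) : ℕ × ℕ)]
      exact (isWeightedHomogeneous_C _ _).mul (isWeightedHomogeneous_X _ _ _)
  · rw [divisor_zForm_ideal]
    simp [dehomogenize, zForm]

section Subscheme

variable (Z : Quadric.IdealSheafData)

/-! ### Functions on a closed subscheme -/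

/-- Restriction of functions to the closed subscheme `Z`. -/
def toSub (U : Quadric.Opens) : Γ(Quadric, U) →+* Γ(Z.subscheme, Z.subschemeι ⁻¹ᵁ U) :=
  (Z.subschemeι.app U).hom

variable {Z} in
/-- Restriction of functions on `Z` to open subsets. -/
def subRes {U V : Z.subscheme.Opens} (h : U ≤ V) : Γ(Z.subscheme, V) →+* Γ(Z.subscheme, U) :=
  (Z.subscheme.presheaf.map (homOfLE h).op).hom

/-- The intersection of `Z` with a chart. -/
abbrev piece (a : Fin 2 × Fin 2) : Z.subscheme.Opens := Z.subschemeι ⁻¹ᵁ (chart a).1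

lemma toSub_res {U V : Quadric.Opens} (h : U ≤ V) (f : Γ(Quadric, V)) :
    toSub Z U (res h f) = subRes (Z.subschemeι.preimage_mono h) (toSub Z V f) :=
  congr($(Z.subschemeι.naturality (homOfLE h).op) f)

lemma toSub_surjective (U : Quadric.affineOpens) : Function.Surjective (toSub Z U.1) :=
  Z.subschemeι_app_surjective U

lemma toSub_eq_zero_iff (U : Quadric.affineOpens) (f : Γ(Quadric, U.1)) :
    toSub Z U.1 f = 0 ↔ f ∈ Z.ideal U := by
  rw [← Z.ker_subschemeι_app U]
  rfl

lemma iSup_piece : ⨆ a, piece Z a = ⊤ := by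
  refine eq_top_iff.mpr fun y _ ↦ ?_
  have h : Z.subschemeι y ∈ ⨆ a, (chart a).1 := iSup_chart ▸ trivial
  obtain ⟨a, ha⟩ := TopologicalSpace.Opens.mem_iSup.mp h
  exact TopologicalSpace.Opens.mem_iSup.mpr ⟨a, ha⟩

lemma toSub_basicOpen {U : Quadric.Opens} (f : Γ(Quadric, U)) :
    Z.subscheme.basicOpen (toSub Z U f) = Z.subschemeι ⁻¹ᵁ (Quadric.basicOpen f) :=
  (Scheme.preimage_basicOpen _ _).symm

lemma subRes_basicOpen {U V : Z.subscheme.Opens} (h : U ≤ V) (f : Γ(Z.subscheme, V)) :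
    Z.subscheme.basicOpen (subRes h f) = U ⊓ Z.subscheme.basicOpen f :=
  Scheme.basicOpen_res _ _ _

instance algebraSub : Algebra ℂ Γ(Z.subscheme, ⊤) :=
  ((structureMorphism Z).appTop.hom.comp (Scheme.ΓSpecIso (.of ℂ)).inv.hom).toAlgebra

lemma length_eq : length Z = Module.finrank ℂ Γ(Z.subscheme, ⊤) := rfl

lemma subRes_algebraMap (U : Quadric.Opens) (c : ℂ) :
    subRes (le_top : Z.subschemeι ⁻¹ᵁ U ≤ ⊤) (algebraMap ℂ Γ(Z.subscheme, ⊤) c) =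
      toSub Z U (const U c) := by
  rw [const, RingHom.comp_apply, toSub_res]
  congr 1

variable {Z}

lemma eq_of_subRes_eq {f g : Γ(Z.subscheme, ⊤)}
    (h : ∀ a, subRes (le_top : piece Z a ≤ ⊤) f = subRes le_top g) : f = g :=
  Z.subscheme.sheaf.eq_of_locally_eq' (piece Z) ⊤ (fun _ ↦ homOfLE le_top) (iSup_piece Z).ge f g h

lemma exists_glue (s : ∀ a, Γ(Z.subscheme, piece Z a))
    (hs : ∀ a b, subRes (inf_le_left : piece Z a ⊓ piece Z b ≤ _) (s a) =
      subRes (inf_le_right : piece Z a ⊓ piece Z b ≤ _) (s b)) :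
    ∃ f : Γ(Z.subscheme, ⊤), ∀ a, subRes (le_top : piece Z a ≤ ⊤) f = s a := by
  obtain ⟨f, hf, -⟩ := Z.subscheme.sheaf.existsUnique_gluing' (piece Z) ⊤
    (fun _ ↦ homOfLE le_top) (iSup_piece Z).ge s hs
  exact ⟨f, hf⟩

/-- Fractions `f a / w a` that agree on overlaps glue to a function on `Z`. -/
lemma exists_glue_div (w f : ∀ a, Γ(Quadric, (chart a).1))
    (hw : ∀ a, IsUnit (toSub Z (chart a).1 (w a)))
    (hf : ∀ a b, res (chart₂_le_left a b) (f a) * res (chart₂_le_right a b) (w b) -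
      res (chart₂_le_right a b) (f b) * res (chart₂_le_left a b) (w a) ∈ Z.ideal (chart₂ a b)) :
    ∃ s : Γ(Z.subscheme, ⊤), ∀ a, toSub Z (chart a).1 (f a) =
      toSub Z (chart a).1 (w a) * subRes (le_top : piece Z a ≤ ⊤) s := by
  choose w' hw' using fun a ↦ (hw a).exists_right_inv
  obtain ⟨s, hs⟩ := exists_glue (fun a ↦ (toSub Z (chart a).1 (f a) * w' a :
      Γ(Z.subscheme, piece Z a))) (fun a b ↦ by
    have h := (toSub_eq_zero_iff Z _ _).mpr (hf a b)
    rw [map_sub, map_mul, map_mul, toSub_res, toSub_res, toSub_res, toSub_res] at h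
    have ha := congrArg (subRes (inf_le_left : piece Z a ⊓ piece Z b ≤ _)) (hw' a)
    have hb := congrArg (subRes (inf_le_right : piece Z a ⊓ piece Z b ≤ _)) (hw' b)
    rw [map_mul, map_one] at ha hb
    rw [map_mul, map_mul]
    set Fa := subRes (inf_le_left : piece Z a ⊓ piece Z b ≤ _) (toSub Z (chart a).1 (f a))
    set Fb := subRes (inf_le_right : piece Z a ⊓ piece Z b ≤ _) (toSub Z (chart b).1 (f b))
    set Wa := subRes (inf_le_left : piece Z a ⊓ piece Z b ≤ _) (toSub Z (chart a).1 (w a))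
    set Wb := subRes (inf_le_right : piece Z a ⊓ piece Z b ≤ _) (toSub Z (chart b).1 (w b))
    set Va := subRes (inf_le_left : piece Z a ⊓ piece Z b ≤ _) (w' a)
    set Vb := subRes (inf_le_right : piece Z a ⊓ piece Z b ≤ _) (w' b)
    have h' : Fa * Wb - Fb * Wa = 0 := h
    linear_combination Va * Vb * h' - Fa * Va * hb + Fb * Vb * ha)
  refine ⟨s, fun a ↦ ?_⟩
  rw [hs]
  have := hw' a
  calc _ = toSub Z (chart a).1 (f a) * (toSub Z (chart a).1 (w a) * w' a) := by
        rw [this]; exact (mul_one _).symm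
    _ = _ := by ring

/-! ### Linear forms that do not vanish on a finite subscheme -/

lemma finite_of_isFiniteScheme (hZ : IsFiniteScheme Z) : Finite Z.subscheme := by
  have : IsFinite (structureMorphism Z) := hZ
  have : Subsingleton (Spec (CommRingCat.of ℂ)) :=
    inferInstanceAs (Subsingleton (PrimeSpectrum ℂ))
  rw [← Set.finite_univ_iff]
  rcases isEmpty_or_nonempty Z.subscheme with h | ⟨⟨y⟩⟩
  · exact Set.toFinite _
  · refine (Scheme.Hom.finite_preimage_singleton (structureMorphism Z)
      (structureMorphism Z y)).subset fun x _ ↦ ?_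
    exact Subsingleton.elim _ _

/-- For each point and chart at most one `α` is bad: two would put both `r a 0` and `r a 1` in the
maximal ideal of the stalk, although one of them is `1`. Finitely many points exclude finitely many
values of the infinite field `ℂ`. -/
lemma exists_isUnit_toSub [Finite Z.subscheme] (r : ∀ a, Fin 2 → Γ(Quadric, (chart a).1))
    (hr : ∀ a, r a 0 = 1 ∨ r a 1 = 1) :
    ∃ α : ℂ, ∀ a, IsUnit (toSub Z (chart a).1 (const _ 1 * r a 0 + const _ α * r a 1)) := by
  let bad : Z.subscheme → (Fin 2 × Fin 2) → Set ℂ := fun y a ↦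
    {α | ∃ hy : y ∈ piece Z a, ¬ IsUnit (Z.subscheme.presheaf.germ (piece Z a) y hy
      (toSub Z (chart a).1 (const _ 1 * r a 0 + const _ α * r a 1)))}
  have hbad : ∀ y a, (bad y a).Subsingleton := by
    rintro y a α ⟨hy, hα⟩ β ⟨_, hβ⟩
    by_contra hne
    let φ : Γ(Quadric, (chart a).1) →+* Z.subscheme.presheaf.stalk y :=
      (Z.subscheme.presheaf.germ (piece Z a) y hy).hom.comp (toSub Z (chart a).1)
    replace hα : φ (const _ 1 * r a 0 + const _ α * r a 1) ∈ IsLocalRing.maximalIdeal _ := hα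
    replace hβ : φ (const _ 1 * r a 0 + const _ β * r a 1) ∈ IsLocalRing.maximalIdeal _ := hβ
    have hu : IsUnit (φ (const _ (α - β))) :=
      ((sub_ne_zero.mpr hne).isUnit.map (const (chart a).1)).map φ
    have h1 : φ (r a 1) ∈ IsLocalRing.maximalIdeal (Z.subscheme.presheaf.stalk y) := by
      rw [← Ideal.unit_mul_mem_iff_mem _ hu]
      convert sub_mem hα hβ using 1
      simp only [map_add, map_mul, map_sub]
      ring
    have h0 : φ (r a 0) ∈ IsLocalRing.maximalIdeal (Z.subscheme.presheaf.stalk y) := by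
      convert sub_mem hα (Ideal.mul_mem_left _ (φ (const _ α)) h1) using 1
      simp only [map_add, map_mul, map_one]
      ring
    have : (1 : Z.subscheme.presheaf.stalk y) ∉ IsLocalRing.maximalIdeal _ := fun h ↦
      (Ideal.ne_top_iff_one _).mp (IsLocalRing.maximalIdeal.isMaximal _).ne_top h
    rcases hr a with h | h
    · rw [h, map_one] at h0; exact this h0
    · rw [h, map_one] at h1; exact this h1
  have hfin : (⋃ y, ⋃ a, bad y a).Finite :=
    Set.finite_iUnion fun y ↦ Set.finite_iUnion fun a ↦ (hbad y a).finite
  obtain ⟨α, hα⟩ := hfin.infinite_compl.nonempty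
  simp only [Set.mem_compl_iff, Set.mem_iUnion, not_exists] at hα
  refine ⟨α, fun a ↦ ?_⟩
  refine RingedSpace.isUnit_of_isUnit_germ _ _ _ fun y hy ↦ ?_
  by_contra h
  exact hα y a ⟨hy, h⟩

variable (Z) in
/-- Affine coordinates on a closed subscheme `Z` of the quadric that is disjoint from the lines
`x₀ + α x₁ = 0` and `z₀ + β z₁ = 0`: the functions `u k = x_k / (x₀ + α x₁)` and
`v k = z_k / (z₀ + β z₁)`. -/
structure Coordinates where
  α : ℂ
  β : ℂ
  u : Fin 2 → Γ(Z.subscheme, ⊤)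
  v : Fin 2 → Γ(Z.subscheme, ⊤)
  isUnit_x : ∀ a, IsUnit (toSub Z (chart a).1 (xForm 1 α a))
  isUnit_z : ∀ a, IsUnit (toSub Z (chart a).1 (zForm 1 β a))
  toSub_x : ∀ a k, toSub Z (chart a).1 (xRatio a k) =
    toSub Z (chart a).1 (xForm 1 α a) * subRes (le_top : piece Z a ≤ ⊤) (u k)
  toSub_z : ∀ a k, toSub Z (chart a).1 (zRatio a k) =
    toSub Z (chart a).1 (zForm 1 β a) * subRes (le_top : piece Z a ≤ ⊤) (v k)

lemma nonempty_coordinates [Finite Z.subscheme] : Nonempty (Coordinates Z) := by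
  have h : ∀ i : Fin 2, i = 0 ∨ i = 1 := by decide
  obtain ⟨α, hα⟩ := exists_isUnit_toSub (Z := Z) xRatio fun a ↦ by
    have := xRatio_self a
    rcases h a.1 with h | h <;> rw [h] at this
    · exact .inl this
    · exact .inr this
  obtain ⟨β, hβ⟩ := exists_isUnit_toSub (Z := Z) zRatio fun a ↦ by
    have := zRatio_self a
    rcases h a.2 with h | h <;> rw [h] at this
    · exact .inl this
    · exact .inr this
  choose u hu using fun k ↦ exists_glue_div (xForm 1 α) (fun a ↦ xRatio a k) hα fun a b ↦ by
    rw [res_xForm 1 α (chart₂_le_left a b) (chart₂_le_right a b),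
      res_xRatio k (chart₂_le_left a b) (chart₂_le_right a b)]
    refine Set.mem_of_eq_of_mem ?_ (Z.ideal (chart₂ a b)).zero_mem
    ring
  choose v hv using fun k ↦ exists_glue_div (zForm 1 β) (fun a ↦ zRatio a k) hβ fun a b ↦ by
    rw [res_zForm 1 β (chart₂_le_left a b) (chart₂_le_right a b),
      res_zRatio k (chart₂_le_left a b) (chart₂_le_right a b)]
    refine Set.mem_of_eq_of_mem ?_ (Z.ideal (chart₂ a b)).zero_mem
    ring
  exact ⟨⟨α, β, u, v, hα, hβ, fun a k ↦ hu k a, fun a k ↦ hv k a⟩⟩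

end Subscheme

/-! ### Functions on a finite closed subscheme -/

section

variable {Z : Quadric.IdealSheafData}

lemma isAffine_subscheme (hZ : IsFiniteScheme Z) : IsAffine Z.subscheme := by
  have : IsFinite (structureMorphism Z) := hZ
  exact isAffine_of_isAffineHom (structureMorphism Z)

lemma finiteDimensional_sections (hZ : IsFiniteScheme Z) :
    FiniteDimensional ℂ Γ(Z.subscheme, ⊤) := by
  have : IsFinite (structureMorphism Z) := hZ
  have h := (structureMorphism Z).finite_appTop
  exact h.comp (RingHom.Finite.of_surjective _
    (ConcreteCategory.bijective_of_isIso (Scheme.ΓSpecIso (.of ℂ)).inv).2)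

lemma subRes_algebraMap_piece (a : Fin 2 × Fin 2) (c : ℂ) :
    subRes (le_top : piece Z a ≤ ⊤) (algebraMap ℂ Γ(Z.subscheme, ⊤) c) =
      toSub Z (chart a).1 (const (chart a).1 c) :=
  subRes_algebraMap Z _ c

end

/-! ### The affine coordinates generate the ring of functions on `Z`. -/

namespace Coordinates

variable {Z : Quadric.IdealSheafData} (T : Coordinates Z)

lemma toSub_xForm (p q : ℂ) (a : Fin 2 × Fin 2) :
    toSub Z (chart a).1 (xForm p q a) = toSub Z (chart a).1 (xForm 1 T.α a) *
      subRes (le_top : piece Z a ≤ ⊤) (algebraMap ℂ _ p * T.u 0 + algebraMap ℂ _ q * T.u 1) := by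
  rw [xForm, map_add, map_mul, map_mul, T.toSub_x, T.toSub_x, map_add, map_mul, map_mul,
    subRes_algebraMap_piece, subRes_algebraMap_piece]
  ring

lemma toSub_zForm (p q : ℂ) (a : Fin 2 × Fin 2) :
    toSub Z (chart a).1 (zForm p q a) = toSub Z (chart a).1 (zForm 1 T.β a) *
      subRes (le_top : piece Z a ≤ ⊤) (algebraMap ℂ _ p * T.v 0 + algebraMap ℂ _ q * T.v 1) := by
  rw [zForm, map_add, map_mul, map_mul, T.toSub_z, T.toSub_z, map_add, map_mul, map_mul,
    subRes_algebraMap_piece, subRes_algebraMap_piece]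
  ring

lemma u_add : T.u 0 + algebraMap ℂ _ T.α * T.u 1 = 1 := by
  refine eq_of_subRes_eq fun a ↦ (T.isUnit_x a).mul_left_cancel ?_
  have h := T.toSub_xForm 1 T.α a
  rw [map_one, one_mul] at h
  exact h.symm.trans (by rw [map_one]; exact (mul_one _).symm)

lemma v_add : T.v 0 + algebraMap ℂ _ T.β * T.v 1 = 1 := by
  refine eq_of_subRes_eq fun a ↦ (T.isUnit_z a).mul_left_cancel ?_
  have h := T.toSub_zForm 1 T.β a
  rw [map_one, one_mul] at h
  exact h.symm.trans (by rw [map_one]; exact (mul_one _).symm)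

lemma toSub_xForm_mul (a : Fin 2 × Fin 2) :
    toSub Z (chart a).1 (xForm 1 T.α a) * subRes (le_top : piece Z a ≤ ⊤) (T.u a.1) = 1 := by
  rw [← T.toSub_x, xRatio_self, map_one]

lemma toSub_zForm_mul (a : Fin 2 × Fin 2) :
    toSub Z (chart a).1 (zForm 1 T.β a) * subRes (le_top : piece Z a ≤ ⊤) (T.v a.2) = 1 := by
  rw [← T.toSub_z, zRatio_self, map_one]

/-- The function on `Z` whose nonvanishing locus is the intersection of `Z` with `U_a`. -/
def bump (a : Fin 2 × Fin 2) : Γ(Z.subscheme, ⊤) := T.u a.1 * T.v a.2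

lemma basicOpen_bump (a : Fin 2 × Fin 2) : Z.subscheme.basicOpen (T.bump a) = piece Z a := by
  apply le_antisymm
  · intro y hy
    obtain ⟨b, hb⟩ := TopologicalSpace.Opens.mem_iSup.mp (iSup_piece Z ▸ trivial : y ∈ ⨆ b, piece Z b)
    have h : toSub Z (chart b).1 (xRatio b a.1 * zRatio b a.2) =
        (toSub Z (chart b).1 (xForm 1 T.α b) * toSub Z (chart b).1 (zForm 1 T.β b)) *
          subRes (le_top : piece Z b ≤ ⊤) (T.bump a) := by
      rw [map_mul, T.toSub_x, T.toSub_z, bump, map_mul]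
      ring
    have h' := congrArg Z.subscheme.basicOpen h
    rw [Scheme.basicOpen_mul, Scheme.basicOpen_of_isUnit _ ((T.isUnit_x b).mul (T.isUnit_z b)),
      subRes_basicOpen, toSub_basicOpen, ← chart₂_eq_basicOpen] at h'
    have hy' : y ∈ Z.subschemeι ⁻¹ᵁ (chart₂ b a).1 := h' ▸ ⟨hb, hb, hy⟩
    exact hy'.2
  · have hu : IsUnit (subRes (le_top : piece Z a ≤ ⊤) (T.bump a)) := by
      refine .of_mul_eq_one_right (toSub Z (chart a).1 (xForm 1 T.α a) *
        toSub Z (chart a).1 (zForm 1 T.β a)) ?_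
      rw [bump, map_mul]
      linear_combination (toSub Z (chart a).1 (zForm 1 T.β a) *
        subRes (le_top : piece Z a ≤ ⊤) (T.v a.2)) * T.toSub_xForm_mul a + T.toSub_zForm_mul a
    have := Scheme.basicOpen_of_isUnit _ hu
    rw [subRes_basicOpen] at this
    exact inf_eq_left.mp this

/-- Expansion of `(u₀ + α u₁)(v₀ + β v₁) = 1`. It provides the partition of unity behind the
local-to-global arguments below. -/
lemma sum_bump : ∑ a : Fin 2 × Fin 2, (algebraMap ℂ _ T.α ^ (a.1 : ℕ) *
    algebraMap ℂ _ T.β ^ (a.2 : ℕ)) * T.bump a = 1 := by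
  simp only [Fintype.sum_prod_type, Fin.sum_univ_two, bump, Fin.val_zero, Fin.val_one, pow_zero,
    pow_one]
  linear_combination (T.v 0 + algebraMap ℂ _ T.β * T.v 1) * T.u_add + T.v_add

variable [IsAffine Z.subscheme]

lemma exists_bump_pow_mul_eq_zero (a : Fin 2 × Fin 2) (f : Γ(Z.subscheme, ⊤))
    (hf : subRes (le_top : piece Z a ≤ ⊤) f = 0) : ∃ N : ℕ, T.bump a ^ N * f = 0 :=
  exists_pow_mul_eq_zero (isAffineOpen_top _) (homOfLE le_top) (T.basicOpen_bump a).symm f hf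

lemma exists_mul_bump_pow_eq (a : Fin 2 × Fin 2) (f : Γ(Z.subscheme, piece Z a)) :
    ∃ (N : ℕ) (f' : Γ(Z.subscheme, ⊤)),
      f * subRes (le_top : piece Z a ≤ ⊤) (T.bump a) ^ N = subRes le_top f' :=
  exists_mul_pow_eq_map (isAffineOpen_top _) (homOfLE le_top) (T.basicOpen_bump a).symm f

/-- On `Z ∩ U_a` every function is a polynomial in the two affine ratios, and a power of `bump a`
turns it into a polynomial in the `u k`, `v k`. The partition of unity `sum_bump` assembles these
memberships, since `u 0` and `v 0` also lie in the subalgebra. -/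
lemma adjoin_eq_top : Algebra.adjoin ℂ {T.u 1, T.v 1} = ⊤ := by
  set B := Algebra.adjoin ℂ {T.u 1, T.v 1} with hB
  have hu1 : T.u 1 ∈ B := Algebra.subset_adjoin (by simp)
  have hv1 : T.v 1 ∈ B := Algebra.subset_adjoin (by simp)
  have hu : ∀ k, T.u k ∈ B := by
    refine Fin.forall_fin_two.mpr ⟨?_, hu1⟩
    rw [eq_sub_of_add_eq T.u_add]
    exact sub_mem (one_mem _) (mul_mem (B.algebraMap_mem _) hu1)
  have hv : ∀ k, T.v k ∈ B := by
    refine Fin.forall_fin_two.mpr ⟨?_, hv1⟩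
    rw [eq_sub_of_add_eq T.v_add]
    exact sub_mem (one_mem _) (mul_mem (B.algebraMap_mem _) hv1)
  have hp : ∀ a, T.bump a ∈ B := fun a ↦ mul_mem (hu _) (hv _)
  refine eq_top_iff.mpr fun f _ ↦ ?_
  refine Subalgebra.mem_of_finsetSum_eq_one_of_pow_smul_mem B Finset.univ T.bump _ T.sum_bump hp
    (fun a ↦ mul_mem (pow_mem (B.algebraMap_mem _) _) (pow_mem (B.algebraMap_mem _) _)) f
    fun a ↦ ?_
  have key : ∀ q : MvPolynomial (Fin 2) ℂ, ∃ N : ℕ, ∃ b ∈ B,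
      subRes (le_top : piece Z a ≤ ⊤) b = subRes (le_top : piece Z a ≤ ⊤) (T.bump a) ^ N *
        toSub Z (chart a).1 (chartEval a q) := by
    intro q
    induction q using MvPolynomial.induction_on with
    | C c =>
      refine ⟨0, algebraMap ℂ _ c, B.algebraMap_mem c, ?_⟩
      rw [subRes_algebraMap_piece, pow_zero, one_mul]
      simp [chartEval]
    | add q r hq hr =>
      obtain ⟨N, b, hb, hb'⟩ := hq
      obtain ⟨M, c, hc, hc'⟩ := hr
      refine ⟨N + M, T.bump a ^ M * b + T.bump a ^ N * c,
        add_mem (mul_mem (pow_mem (hp a) _) hb) (mul_mem (pow_mem (hp a) _) hc), ?_⟩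
      simp only [map_add, map_mul, map_pow, hb', hc']
      ring
    | mul_X q k hq =>
      obtain ⟨N, b, hb, hb'⟩ := hq
      have hk : ∃ c ∈ B, subRes (le_top : piece Z a ≤ ⊤) c =
          subRes (le_top : piece Z a ≤ ⊤) (T.bump a) *
            toSub Z (chart a).1 (chartEval a (.X k)) := by
        revert k
        refine Fin.forall_fin_two.mpr ⟨?_, ?_⟩
        · refine ⟨T.u (1 - a.1) * T.v a.2, mul_mem (hu _) (hv _), ?_⟩
          have : chartEval a (.X 0) = xRatio a (1 - a.1) := by simp [chartEval]
          rw [this, T.toSub_x, bump, map_mul, map_mul]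
          linear_combination -(subRes (le_top : piece Z a ≤ ⊤) (T.u (1 - a.1)) *
            subRes (le_top : piece Z a ≤ ⊤) (T.v a.2)) * T.toSub_xForm_mul a
        · refine ⟨T.u a.1 * T.v (1 - a.2), mul_mem (hu _) (hv _), ?_⟩
          have : chartEval a (.X 1) = zRatio a (1 - a.2) := by simp [chartEval]
          rw [this, T.toSub_z, bump, map_mul, map_mul]
          linear_combination -(subRes (le_top : piece Z a ≤ ⊤) (T.u a.1) *
            subRes (le_top : piece Z a ≤ ⊤) (T.v (1 - a.2))) * T.toSub_zForm_mul a
      obtain ⟨c, hc, hc'⟩ := hk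
      refine ⟨N + 1, b * c, mul_mem hb hc, ?_⟩
      rw [map_mul, map_mul, map_mul, hb', hc']
      ring
  obtain ⟨g, hg⟩ := toSub_surjective Z (chart a) (subRes (le_top : piece Z a ≤ ⊤) f)
  obtain ⟨q, rfl⟩ := (chartEval_bijective a).2 g
  obtain ⟨N, b, hb, hb'⟩ := key q
  -- The two functions agree only on `Z ∩ U_a`; one more power of `bump a` makes them agree on all
  -- of `Z`.
  obtain ⟨M, hM⟩ := T.exists_bump_pow_mul_eq_zero a (b - T.bump a ^ N * f) (by
    rw [map_sub, map_mul, map_pow, hb', hg]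
    exact sub_self _)
  refine ⟨M + N, ?_⟩
  have : T.bump a ^ (M + N) • f = T.bump a ^ M * b := by
    rw [smul_eq_mul]
    linear_combination -hM
  rw [this]
  exact mul_mem (pow_mem (hp a) _) hb

/-! ### Intersections with divisors -/

lemma mem_span_of_locally (T : Coordinates Z) {ℓ f : Γ(Z.subscheme, ⊤)}
    (h : ∀ a, ∃ c, subRes (le_top : piece Z a ≤ ⊤) f = subRes (le_top : piece Z a ≤ ⊤) ℓ * c) :
    f ∈ Ideal.span {ℓ} := by
  refine Submodule.mem_of_span_eq_top_of_smul_pow_mem (Ideal.span {ℓ}) (Set.range T.bump) ?_ f ?_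
  · rw [Ideal.eq_top_iff_one, ← T.sum_bump]
    exact sum_mem fun a _ ↦ Ideal.mul_mem_left _ _ (Ideal.subset_span ⟨a, rfl⟩)
  · rintro ⟨_, a, rfl⟩
    obtain ⟨c, hc⟩ := h a
    obtain ⟨N, e, he⟩ := T.exists_mul_bump_pow_eq a c
    obtain ⟨M, hM⟩ := T.exists_bump_pow_mul_eq_zero a (T.bump a ^ N * f - ℓ * e) (by
      rw [map_sub, map_mul, map_mul, map_pow, ← he, hc]
      ring)
    refine ⟨M + N, Ideal.mem_span_singleton.mpr ⟨T.bump a ^ M * e, ?_⟩⟩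
    rw [smul_eq_mul]
    linear_combination hM

end Coordinates

/-! ### Comparing quotients of the ring of `Z` with intersections `Z ∩ D`. -/

section

variable {Z W : Quadric.IdealSheafData}

/-- Restriction of functions to a smaller closed subscheme. -/
def restrict (h : Z ≤ W) : Γ(Z.subscheme, ⊤) →ₐ[ℂ] Γ(W.subscheme, ⊤) where
  toRingHom := (Scheme.IdealSheafData.inclusion h).appTop.hom
  commutes' c := by
    have e : Scheme.IdealSheafData.inclusion h ≫ structureMorphism Z = structureMorphism W := by
      rw [structureMorphism, structureMorphism, ← Category.assoc,
        Scheme.IdealSheafData.inclusion_subschemeι]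
    change _ = (structureMorphism W).appTop.hom _
    rw [← e, Scheme.Hom.comp_appTop]
    rfl

lemma restrict_surjective [IsAffine Z.subscheme] (h : Z ≤ W) :
    Function.Surjective (restrict h) := by
  have : IsClosedImmersion (Scheme.IdealSheafData.inclusion h ≫ Z.subschemeι) := by
    rw [Scheme.IdealSheafData.inclusion_subschemeι]
    infer_instance
  have := IsClosedImmersion.of_comp_isClosedImmersion (Scheme.IdealSheafData.inclusion h)
    Z.subschemeι
  exact (IsClosedImmersion.isAffine_surjective_of_isAffine
    (Scheme.IdealSheafData.inclusion h)).2

lemma mem_ideal_of_restrict_eq_zero (h : Z ≤ W) {f : Γ(Z.subscheme, ⊤)} (hf : restrict h f = 0)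
    (a : Fin 2 × Fin 2) (g : Γ(Quadric, (chart a).1))
    (hg : toSub Z (chart a).1 g = subRes (le_top : piece Z a ≤ ⊤) f) : g ∈ W.ideal (chart a) := by
  rw [← toSub_eq_zero_iff]
  have key : ∀ j : W.subscheme ⟶ Quadric, Scheme.IdealSheafData.inclusion h ≫ Z.subschemeι = j →
      j.app (chart a).1 g = 0 := by
    rintro _ rfl
    rw [Scheme.Hom.comp_app]
    change (Scheme.IdealSheafData.inclusion h).app _ (toSub Z (chart a).1 g) = 0
    rw [hg]
    have := congr($((Scheme.IdealSheafData.inclusion h).naturality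
      (homOfLE (le_top : piece Z a ≤ ⊤)).op) f)
    refine this.trans ?_
    change (W.subscheme.presheaf.map _) (restrict h f) = 0
    rw [hf, map_zero]
  exact key _ (Scheme.IdealSheafData.inclusion_subschemeι h)

/-- A function on `Z` vanishing on `Z ∩ D` lies, on each chart, in `I_Z + (L a)`, so it is locally a
multiple of `ℓ` and hence globally one. Thus `A / (ℓ)` is a quotient of the ring of `Z ∩ D`. -/
lemma Coordinates.finrank_quotient_le_length (T : Coordinates Z) [IsAffine Z.subscheme]
    [FiniteDimensional ℂ Γ(Z.subscheme, ⊤)] (D : Quadric.IdealSheafData)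
    (L : ∀ a, Γ(Quadric, (chart a).1)) (hD : ∀ a, D.ideal (chart a) = Ideal.span {L a})
    (ℓ : Γ(Z.subscheme, ⊤)) (hℓ : ∀ a, ∃ c, toSub Z (chart a).1 (L a) =
      subRes (le_top : piece Z a ≤ ⊤) ℓ * c) :
    Module.finrank ℂ (Γ(Z.subscheme, ⊤) ⧸ Ideal.span {ℓ}) ≤ length (Z ⊔ D) := by
  let φ := restrict (le_sup_left : Z ≤ Z ⊔ D)
  have hφ : Function.Surjective φ := restrict_surjective _
  have hker : RingHom.ker φ ≤ Ideal.span {ℓ} := by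
    intro f hf
    refine T.mem_span_of_locally fun a ↦ ?_
    obtain ⟨g, hg⟩ := toSub_surjective Z (chart a) (subRes (le_top : piece Z a ≤ ⊤) f)
    have h := mem_ideal_of_restrict_eq_zero _ hf a g hg
    rw [Scheme.IdealSheafData.ideal_sup, Pi.sup_apply, hD] at h
    obtain ⟨z, hz, d, hd, rfl⟩ := Submodule.mem_sup.mp h
    obtain ⟨e, rfl⟩ := Ideal.mem_span_singleton.mp hd
    obtain ⟨c, hc⟩ := hℓ a
    refine ⟨c * toSub Z (chart a).1 e, ?_⟩
    rw [← hg, map_add, (toSub_eq_zero_iff Z _ _).mpr hz, zero_add, map_mul, hc, mul_assoc]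
  rw [length_eq, ← (Ideal.quotientKerAlgEquivOfSurjective hφ).toLinearEquiv.finrank_eq]
  exact LinearMap.finrank_le_finrank_of_surjective
    (f := (Ideal.Quotient.factorₐ ℂ hker).toLinearMap) (Ideal.Quotient.factor_surjective hker)

end

/-! ### Length bounds from lines, and restriction of global sections of `𝒪(m, n)` to `Z`. -/

section Vanishing

variable {Z : Quadric.IdealSheafData}

namespace Coordinates

variable (T : Coordinates Z)

lemma finrank_quotient_u_le [IsAffine Z.subscheme] [FiniteDimensional ℂ Γ(Z.subscheme, ⊤)]
    {n : ℕ} (hD : ∀ D : Quadric.IdealSheafData, IsCurve 1 0 D → length (Z ⊔ D) ≤ n) (c : ℂ) :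
    Module.finrank ℂ (Γ(Z.subscheme, ⊤) ⧸ Ideal.span {T.u 1 - algebraMap ℂ _ c}) ≤ n := by
  -- The coefficients are those of `x₁ - c (x₀ + α x₁)`, which restricts to `u 1 - c` times the unit
  -- `x₀ + α x₁`.
  refine (T.finrank_quotient_le_length _ _ (divisor_xForm_ideal (-c) (1 - c * T.α)) _
    fun a ↦ ⟨toSub Z (chart a).1 (xForm 1 T.α a), ?_⟩).trans (hD _ (isCurve_divisor_xForm ?_))
  · rw [T.toSub_xForm, mul_comm]
    congr 2
    simp only [map_sub, map_neg, map_mul, map_one]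
    linear_combination -algebraMap ℂ _ c * T.u_add
  · by_cases hc : c = 0
    · simp [hc]
    · simp [hc]

lemma finrank_quotient_v_le [IsAffine Z.subscheme] [FiniteDimensional ℂ Γ(Z.subscheme, ⊤)]
    {n : ℕ} (hE : ∀ E : Quadric.IdealSheafData, IsCurve 0 1 E → length (Z ⊔ E) ≤ n) (c : ℂ) :
    Module.finrank ℂ (Γ(Z.subscheme, ⊤) ⧸ Ideal.span {T.v 1 - algebraMap ℂ _ c}) ≤ n := by
  refine (T.finrank_quotient_le_length _ _ (divisor_zForm_ideal (-c) (1 - c * T.β)) _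
    fun a ↦ ⟨toSub Z (chart a).1 (zForm 1 T.β a), ?_⟩).trans (hE _ (isCurve_divisor_zForm ?_))
  · rw [T.toSub_zForm, mul_comm]
    congr 2
    simp only [map_sub, map_neg, map_mul, map_one]
    linear_combination -algebraMap ℂ _ c * T.v_add
  · by_cases hc : c = 0
    · simp [hc]
    · simp [hc]

/-- The trivialization `(x₀ + α x₁) ^ m (z₀ + β z₁) ^ n` of `𝒪(m, n)` on `Z`, over `U_a`. -/
def frame (m n : ℕ) (a : Fin 2 × Fin 2) : Γ(Quadric, (chart a).1) :=
  xForm 1 T.α a ^ m * zForm 1 T.β a ^ n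

lemma isUnit_frame (m n : ℕ) (a : Fin 2 × Fin 2) :
    IsUnit (toSub Z (chart a).1 (T.frame m n a)) := by
  rw [frame, map_mul, map_pow, map_pow]
  exact ((T.isUnit_x a).pow m).mul ((T.isUnit_z a).pow n)

end Coordinates

lemma transition_natCast (m n : ℕ) (a b : Fin 2 × Fin 2) : transition m n a b =
    res (chart₂_le_left a b) (xRatio a b.1) ^ m * res (chart₂_le_left a b) (zRatio a b.2) ^ n := by
  simp [transition]

lemma Coordinates.res_frame (T : Coordinates Z) (m n : ℕ) (a b : Fin 2 × Fin 2) :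
    res (chart₂_le_left a b) (T.frame m n a) =
      transition m n a b * res (chart₂_le_right a b) (T.frame m n b) := by
  rw [transition_natCast]
  simp only [frame, map_mul, map_pow]
  rw [res_xForm 1 T.α (chart₂_le_left a b) (chart₂_le_right a b),
    res_zForm 1 T.β (chart₂_le_left a b) (chart₂_le_right a b)]
  ring

/-- Global sections of `𝒪(m, n)` restrict to all functions on `Z` that are polynomials of bidegree
at most `(m, n)` in the coordinates. -/
lemma Coordinates.exists_section (T : Coordinates Z) {m n : ℕ} {σ : Γ(Z.subscheme, ⊤)}
    (hσ : σ ∈ monomialSpan ℂ (T.u 1) (T.v 1) m n) :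
    ∃ s : ∀ a, Γ(Quadric, (chart a).1),
      (∀ a b, transition m n a b * res (chart₂_le_right a b) (s b) =
        res (chart₂_le_left a b) (s a)) ∧
      ∀ a, toSub Z (chart a).1 (s a) =
        toSub Z (chart a).1 (T.frame m n a) * subRes (le_top : piece Z a ≤ ⊤) σ := by
  induction hσ using Submodule.span_induction with
  | zero => exact ⟨0, by simp, by simp⟩
  | mem σ h =>
    obtain ⟨i, hi, j, hj, rfl⟩ := h
    -- The form `x₁ ^ i (x₀ + α x₁) ^ (m - i) z₁ ^ j (z₀ + β z₁) ^ (n - j)`: dividing by the frame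
    -- leaves `u ^ i v ^ j`.
    refine ⟨fun a ↦ xRatio a 1 ^ i * xForm 1 T.α a ^ (m - i) *
      (zRatio a 1 ^ j * zForm 1 T.β a ^ (n - j)), fun a b ↦ ?_, fun a ↦ ?_⟩
    · rw [transition_natCast]
      simp only [map_mul, map_pow]
      rw [res_xForm 1 T.α (chart₂_le_left a b) (chart₂_le_right a b),
        res_zForm 1 T.β (chart₂_le_left a b) (chart₂_le_right a b),
        res_xRatio 1 (chart₂_le_left a b) (chart₂_le_right a b),
        res_zRatio 1 (chart₂_le_left a b) (chart₂_le_right a b)]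
      obtain ⟨k, rfl⟩ := Nat.exists_eq_add_of_le hi
      obtain ⟨k', rfl⟩ := Nat.exists_eq_add_of_le hj
      simp only [Nat.add_sub_cancel_left]
      ring
    · obtain ⟨k, rfl⟩ := Nat.exists_eq_add_of_le hi
      obtain ⟨k', rfl⟩ := Nat.exists_eq_add_of_le hj
      simp only [frame, map_mul, map_pow, Nat.add_sub_cancel_left]
      rw [T.toSub_x, T.toSub_z]
      ring
  | add σ τ _ _ hσ hτ =>
    obtain ⟨s, hs, hs'⟩ := hσ
    obtain ⟨t, ht, ht'⟩ := hτ
    refine ⟨fun a ↦ s a + t a, fun a b ↦ ?_, fun a ↦ ?_⟩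
    · rw [map_add, map_add, mul_add, hs, ht]
    · rw [map_add, map_add, hs', ht', mul_add]
  | smul c σ _ hσ =>
    obtain ⟨s, hs, hs'⟩ := hσ
    refine ⟨fun a ↦ const _ c * s a, fun a b ↦ ?_, fun a ↦ ?_⟩
    · rw [map_mul, map_mul, ← hs, res_const, res_const]
      ring
    · rw [map_mul, Algebra.smul_def, map_mul, hs', subRes_algebraMap_piece]
      ring

/-! ### Vanishing of the first cohomology -/

lemma subsingleton_H1_iff {I : Quadric.IdealSheafData} {m n : ℤ} :
    Subsingleton (H1 I m n) ↔ ∀ g, d1 I m n g = 0 → ∃ f, d0 I m n f = g := by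
  rw [QuotientAddGroup.subsingleton_iff, AddSubgroup.addSubgroupOf_eq_top]
  rfl

/-- A `1`-cocycle of `I(m, n)` is a coboundary of a cochain of `𝒪(m, n)`. -/
lemma exists_cochain_of_d1_eq_zero {I : Quadric.IdealSheafData} {m n : ℤ} (hm : -1 ≤ m)
    (hn : -1 ≤ n) {g : C1 I} (hg : d1 I m n g = 0) :
    ∃ h : ∀ a, Γ(Quadric, (chart a).1), ∀ a b, transition m n a b *
      res (chart₂_le_right a b) (h b) - res (chart₂_le_left a b) (h a) = g a b :=
  exists_cochain_of_cocycle hm hn (fun a b ↦ g a b) fun a b c ↦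
    congrArg Subtype.val (congrFun (congrFun (congrFun hg a) b) c)

lemma exists_d0_eq {I : Quadric.IdealSheafData} {m n : ℤ} {g : C1 I}
    {h : ∀ a, Γ(Quadric, (chart a).1)} (hI : ∀ a, h a ∈ I.ideal (chart a))
    (hg : ∀ a b, transition m n a b * res (chart₂_le_right a b) (h b) -
      res (chart₂_le_left a b) (h a) = g a b) : ∃ f, d0 I m n f = g :=
  ⟨fun a ↦ ⟨h a, hI a⟩, funext fun a ↦ funext fun b ↦ Subtype.ext (hg a b)⟩

/-- If `Z` imposes independent conditions on forms of bidegree `(m, n)`, then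
`H¹(I_Z(m, n)) = 0`. -/
theorem Coordinates.subsingleton_H1 (T : Coordinates Z) {m n : ℕ}
    (h : monomialSpan ℂ (T.u 1) (T.v 1) m n = ⊤) : Subsingleton (H1 Z m n) := by
  refine subsingleton_H1_iff.mpr fun g hg ↦ ?_
  obtain ⟨f, hf⟩ := exists_cochain_of_d1_eq_zero (by lia) (by lia) hg
  -- The coboundary of `f` is `g`, with values in `I_Z`, so `f` restricts to a section of `𝒪(m, n)`
  -- over `Z`; dividing by the frame gives a function `σ`.
  obtain ⟨σ, hσ⟩ := exists_glue_div (T.frame m n) f (T.isUnit_frame m n) fun a b ↦ by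
    rw [T.res_frame]
    refine Set.mem_of_eq_of_mem ?_ ((Z.ideal (chart₂ a b)).mul_mem_left
      (-res (chart₂_le_right a b) (T.frame m n b)) (g a b).2)
    rw [← hf]
    ring
  obtain ⟨s, hs, hs'⟩ := T.exists_section (h ▸ trivial : σ ∈ monomialSpan ℂ (T.u 1) (T.v 1) m n)
  -- Subtracting a global section with the same restriction to `Z` moves the cochain into `I_Z`
  -- without changing its coboundary.
  refine exists_d0_eq (h := fun a ↦ f a - s a) (fun a ↦ ?_) fun a b ↦ ?_
  · rw [← toSub_eq_zero_iff, map_sub, hσ, hs', sub_self]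
  · rw [map_sub, map_sub, mul_sub, hs, ← hf]
    ring

lemma ideal_chart_eq_top_of_length_eq_zero (hZ : IsFiniteScheme Z) (h : length Z = 0)
    (a : Fin 2 × Fin 2) : Z.ideal (chart a) = ⊤ := by
  have := finiteDimensional_sections hZ
  have : Subsingleton Γ(Z.subscheme, ⊤) := Module.finrank_zero_iff.mp h
  rw [Ideal.eq_top_iff_one, ← toSub_eq_zero_iff, map_one,
    ← map_one (subRes (le_top : piece Z a ≤ ⊤)), Subsingleton.elim 1 0, map_zero]

end Vanishing

end QuadricSurface

end

/-! ### The main theorem: the case `n = -1`, then `n ≥ 0`. -/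

open QuadricSurface in
theorem proposition4p3 (c l : ℕ) (m n : ℤ)
    (C Z : AlgebraicGeometry.Scheme.IdealSheafData QuadricSurface.Quadric)
    (hC : QuadricSurface.IsCurve 1 c C)
    (hZC : C ≤ Z)
    (hZ : QuadricSurface.IsFiniteScheme Z)
    (hl : QuadricSurface.length Z = l)
    (hm : 1 ≤ m) (hn : (c : ℤ) - 1 ≤ n) (hmn : (l : ℤ) - 1 ≤ m + n)
    (hD : ∀ D : AlgebraicGeometry.Scheme.IdealSheafData QuadricSurface.Quadric,
      QuadricSurface.IsCurve 1 0 D → (QuadricSurface.length (Z ⊔ D) : ℤ) ≤ n + 1)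
    (hE : ∀ E : AlgebraicGeometry.Scheme.IdealSheafData QuadricSurface.Quadric,
      QuadricSurface.IsCurve 0 1 E → (QuadricSurface.length (Z ⊔ E) : ℤ) ≤ m) :
    Subsingleton (QuadricSurface.H1 Z m n) := by
  rcases lt_or_ge n 0 with h | h
  · obtain rfl : c = 0 := by lia
    obtain rfl : n = -1 := by lia
    -- With `c = 0` the curve `C` is a line containing `Z`, so the bound `n + 1 = 0` applies to the
    -- length of `Z` itself.
    have h0 := hD C hC
    rw [sup_eq_left.mpr hZC] at h0
    refine subsingleton_H1_iff.mpr fun g hg ↦ ?_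
    obtain ⟨f, hf⟩ := exists_cochain_of_d1_eq_zero (by lia) le_rfl hg
    refine exists_d0_eq (fun a ↦ ?_) hf
    rw [ideal_chart_eq_top_of_length_eq_zero hZ (by lia) a]
    trivial
  · lift m to ℕ using by lia
    lift n to ℕ using h
    have := isAffine_subscheme hZ
    have := finiteDimensional_sections hZ
    have := finite_of_isFiniteScheme hZ
    obtain ⟨T⟩ := nonempty_coordinates (Z := Z)
    rw [length_eq] at hl
    -- For lines of bidegree `(0, 1)` the bound `m` is relaxed to the `m + 1` required by the
    -- spanning theorem.
    exact T.subsingleton_H1 (monomialSpan_eq_top _ rfl T.adjoin_eq_top (by lia)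
      (T.finrank_quotient_u_le fun D h ↦ by have := hD D h; lia)
      (T.finrank_quotient_v_le fun E h ↦ by have := hE E h; lia))
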